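/- **Proposition (time-reversal symmetry).** Let $\Gamma\subset\mathbb R^d$ be the lattice generated by a basis $\gamma_1,\dots,\gamma_d$ of $\mathbb R^d$, let $\Gamma^*$ be the dual lattice, generated by the vectors $\gamma_j^*$ with $\gamma_i\cdot\gamma_j^*=2\pi\delta_{ij}$, and let $Y$, $Y^*$ be the corresponding centred fundamental cells, $Y=\{\sum_l\zeta_l\gamma_l:\zeta_l\in[-\frac12,\frac12]\}$ and $Y^*=\{\sum_l\zeta_l\gamma^*_l:\zeta_l\in[-\frac12,\frac12]\}$. Put $\mathcal H_{\rm f}=L^2(\mathbb R^d/\Gamma)\cong L^2(Y)$ and let $$\mathcal Z: L^2(\mathbb R^d)\to L^2(Y^*,|Y^*|^{-1}dk;\mathcal H_{\rm f}),\qquad (\mathcal Z\psi)(k,y)=\sum_{\gamma\in\Gamma}e^{-i(y+\gamma)\cdot k}\,\psi(y+\gamma)$$ (convergence in $L^2$) be the Bloch–Floquet–Zak transform. Let $I\subseteq\mathbb R$ be an interval of positive length. For $t\in I$ let $H(t)$ be a self-adjoint (possibly unbounded) operator in $L^2(\mathbb R^d)$ such that * $H(t)$ commutes with complex conjugation $\mathscr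 C\psi=\overline\psi$: if $\psi$ is in the domain of $H(t)$, then so is $\overline\psi$, and $H(t)\overline\psi=\overline{H(t)\psi}$; * $\mathcal Z H(t)\mathcal Z^{-1}=\int^\oplus_{Y^*}H(k,t)\,dk$ is continuously fibered: the $H(k,t)$, $k\in\mathbb R^d$, are self-adjoint operators in $\mathcal H_{\rm f}$ that depend continuously on $k$ in the (strong) resolvent sense, with $H(k+\gamma^*,t)=e^{-iy\cdot\gamma^*}H(k,t)\,e^{iy\cdot\gamma^*}$ for all $\gamma^*\in\Gamma^*$. For all $k\in\mathbb R^d$, $t\in I$ let $P(k,t)$ be either * (a) $P(k,t)=\mathbf 1_{(-\infty,E(t))}(H(k,t))$, where $E(t)\in\mathbb R$ lies in the resolvent set of $H(t)$; or * (b) $P(k,t)=P_m(k,t)$, the orthogonal projection onto the eigenspace of $H(k,t)$ for the eigenvalue $E_m(k,t)$, where $\mathcal H_{\rm f}$ has, for all $k$ and $t$, an orthonormal basis of eigenvectors of $H(k,t)$ with eigenvalues $E_0(k,t)\le E_1(k,t)\le\dots$, and the $m$-th Bloch band is isolated: for each $t\in I$, $\inf_{k}\operatorname{dist}\big(E_m(k,t),\,\sigma(H(k,t))\setminus\{E_m(k,t)\}\big)>0$.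 Let $\mathscr C_{\rm f}$ be complex conjugation in $\mathcal H_{\rm f}$. Then $$P(k,t)=\mathscr C_{\rm f}\,P(-k,t)\,\mathscr C_{\rm f}\qquad\text{for all }k\in\mathbb R^d,\ t\in I.$$ Moreover the piezocurvature $$\Theta(k,t)=-i\,\operatorname{tr}\big(P(k,t)\,[\partial_tP(k,t),\nabla_kP(k,t)]\big)$$ exists at $(-k,t)$ if and only if it exists at $(k,t)$ (that is, $P$ is norm differentiable in $k$ and in $t$ there and the operators $P[\partial_tP,\partial_{k_j}P]$ are trace class), and then $$\Theta(-k,t)=\Theta(k,t).$$ -/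

import Mathlib

open MeasureTheory

noncomputable section

namespace Piezo

/-! ### Lattice, cells and Hilbert spaces -/

/-- The physical space `ℝ^d` (also used for the crystal momentum). -/
abbrev Space (d : ℕ) : Type := EuclideanSpace ℝ (Fin d)

/-- `L²(ℝ^d)`. -/
abbrev L2 (d : ℕ) : Type := Lp ℂ 2 (volume : Measure (Space d))

/-- The lattice `Γ` generated by the basis `γ`. -/
def lattice {d : ℕ} (γ : Module.Basis (Fin d) ℝ (Space d)) : Submodule ℤ (Space d) :=
  Submodule.span ℤ (Set.range γ)

/-- The centred fundamental cell `{∑ ζ_l γ_l : ζ_l ∈ [-1/2, 1/2]}`. -/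
def cell {d : ℕ} (γ : Module.Basis (Fin d) ℝ (Space d)) : Set (Space d) :=
  {x | ∀ l, γ.repr x l ∈ Set.Icc (-(1 / 2) : ℝ) (1 / 2)}

lemma innerₗ_nondegenerate (d : ℕ) :
    LinearMap.BilinForm.Nondegenerate (innerₗ (Space d) : LinearMap.BilinForm ℝ (Space d)) := by
  refine ⟨fun x hx => ?_, fun x hx => ?_⟩
  · exact inner_self_eq_zero.mp (hx x)
  · exact inner_self_eq_zero.mp (hx x)

/-- The generators `γ*_j` of the dual lattice, `γ_i · γ*_j = 2π δ_ij`. -/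
def dual {d : ℕ} (γ : Module.Basis (Fin d) ℝ (Space d)) : Module.Basis (Fin d) ℝ (Space d) :=
  (LinearMap.BilinForm.dualBasis (innerₗ (Space d)) (innerₗ_nondegenerate d) γ).isUnitSMul
    (w := fun _ => 2 * Real.pi) (fun _ => (mul_ne_zero two_ne_zero Real.pi_ne_zero).isUnit)

lemma inner_dual {d : ℕ} (γ : Module.Basis (Fin d) ℝ (Space d)) (i j : Fin d) :
    inner ℝ (γ i) (dual γ j) = if i = j then 2 * Real.pi else 0 := by
  have h := LinearMap.BilinForm.apply_dualBasis_left (innerₗ_nondegenerate d) γ j i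
  rw [innerₗ_apply_apply] at h
  rw [dual, Module.Basis.isUnitSMul_apply, inner_smul_right, real_inner_comm, h]
  split_ifs <;> simp

/-- The fibre space `H_f = L²(𝕋^d)`, the torus `ℝ^d/Γ` being represented by the cell `Y`. -/
abbrev FiberSpace {d : ℕ} (γ : Module.Basis (Fin d) ℝ (Space d)) : Type :=
  Lp ℂ 2 ((volume : Measure (Space d)).restrict (cell γ))

/-- The normalized Lebesgue measure `|Y*|⁻¹ dk` on the Brillouin zone `Y*`. -/
def brillouinMeasure {d : ℕ} (γ : Module.Basis (Fin d) ℝ (Space d)) : Measure (Space d) :=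
  ProbabilityTheory.cond volume (cell (dual γ))

instance {d : ℕ} (γ : Module.Basis (Fin d) ℝ (Space d)) :
    IsFiniteMeasure (brillouinMeasure γ) := by
  unfold brillouinMeasure; infer_instance

/-- `L²(Y*, |Y*|⁻¹ dk; H_f)`, that is `L²(Y*) ⊗ H_f`. -/
abbrev ZakSpace {d : ℕ} (γ : Module.Basis (Fin d) ℝ (Space d)) : Type :=
  Lp (FiberSpace γ) 2 (brillouinMeasure γ)

/-! ### The Bloch-Floquet-Zak transform -/

lemma norm_phase {d : ℕ} (k y : Space d) :
    ‖Complex.exp (Complex.I * ((-inner ℝ y k : ℝ) : ℂ))‖ = 1 :=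
  Complex.norm_exp_I_mul_ofReal _

lemma memLp_phase {d : ℕ} (γ : Module.Basis (Fin d) ℝ (Space d)) (k : Space d)
    (f : FiberSpace γ) :
    MemLp (fun y => Complex.exp (Complex.I * ((-inner ℝ y k : ℝ) : ℂ)) * f y) 2
      ((volume : Measure (Space d)).restrict (cell γ)) := by
  refine (Lp.memLp f).of_le (AEStronglyMeasurable.mul ?_ (Lp.aestronglyMeasurable f)) ?_
  · exact Continuous.aestronglyMeasurable (by fun_prop)
  · filter_upwards with y
    rw [norm_mul, norm_phase, one_mul]

/-- Multiplication by `y ↦ exp(-i y·k)` on `H_f`. -/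
def phase {d : ℕ} (γ : Module.Basis (Fin d) ℝ (Space d)) (k : Space d) (f : FiberSpace γ) :
    FiberSpace γ :=
  (memLp_phase γ k f).toLp _

/-- `ψ ↦ ψ(· + a)` restricted to the cell `Y`. -/
def shiftRestrict {d : ℕ} (γ : Module.Basis (Fin d) ℝ (Space d)) (a : Space d) (ψ : L2 d) :
    FiberSpace γ :=
  LpToLpRestrictCLM (Space d) ℂ ℂ volume 2 (cell γ)
    (Lp.compMeasurePreserving (fun y => y + a) (measurePreserving_add_right volume a) ψ)

/-- The function `y ↦ exp(-i (y + a)·k) ψ(y + a)` in `H_f`. -/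
def zakSection {d : ℕ} (γ : Module.Basis (Fin d) ℝ (Space d)) (a : Space d) (ψ : L2 d)
    (k : Space d) : FiberSpace γ :=
  Complex.exp (Complex.I * ((-inner ℝ a k : ℝ) : ℂ)) • phase γ k (shiftRestrict γ a ψ)

lemma norm_phase_apply_le {d : ℕ} (γ : Module.Basis (Fin d) ℝ (Space d)) (k : Space d)
    (f : FiberSpace γ) : ‖phase γ k f‖ ≤ 1 * ‖f‖ := by
  refine Lp.norm_le_mul_norm_of_ae_le_mul ?_
  filter_upwards [(memLp_phase γ k f).coeFn_toLp] with y hy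
  rw [phase, hy, norm_mul, norm_phase]

lemma norm_le_of_mem_cell {d : ℕ} (γ : Module.Basis (Fin d) ℝ (Space d)) {y : Space d}
    (hy : y ∈ cell γ) : ‖y‖ ≤ ∑ l, ‖γ l‖ := by
  conv_lhs => rw [← γ.sum_repr y]
  refine (norm_sum_le _ _).trans (Finset.sum_le_sum fun l _ => ?_)
  rw [norm_smul]
  have h1 : ‖γ.repr y l‖ ≤ 1 := by
    rw [Real.norm_eq_abs, abs_le]
    exact ⟨by linarith [(hy l).1], by linarith [(hy l).2]⟩
  exact mul_le_of_le_one_left (norm_nonneg _) h1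

lemma measurableSet_cell {d : ℕ} (γ : Module.Basis (Fin d) ℝ (Space d)) :
    MeasurableSet (cell γ) := by
  have h : cell γ = ⋂ l, (fun x => γ.equivFunL x l) ⁻¹' Set.Icc (-(1 / 2) : ℝ) (1 / 2) := by
    ext x
    simp [cell]
  rw [h]
  refine MeasurableSet.iInter fun l => ?_
  exact measurableSet_Icc.preimage
    (((continuous_apply l).comp γ.equivFunL.continuous).measurable)

lemma norm_phase_sub_le {d : ℕ} (γ : Module.Basis (Fin d) ℝ (Space d)) (k k' : Space d)
    (f : FiberSpace γ) :
    ‖phase γ k f - phase γ k' f‖ ≤ ((∑ l, ‖γ l‖) * ‖k - k'‖) * ‖f‖ := by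
  refine Lp.norm_le_mul_norm_of_ae_le_mul ?_
  filter_upwards [(memLp_phase γ k f).coeFn_toLp, (memLp_phase γ k' f).coeFn_toLp,
    Lp.coeFn_sub (phase γ k f) (phase γ k' f),
    ae_restrict_mem (measurableSet_cell γ)] with y h1 h2 h3 hy
  rw [h3, Pi.sub_apply, phase, phase, h1, h2, ← sub_mul, norm_mul]
  refine mul_le_mul_of_nonneg_right ?_ (norm_nonneg _)
  have h4 : Complex.exp (Complex.I * ((-inner ℝ y k : ℝ) : ℂ)) -
      Complex.exp (Complex.I * ((-inner ℝ y k' : ℝ) : ℂ)) =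
      Complex.exp (Complex.I * ((-inner ℝ y k' : ℝ) : ℂ)) *
        (Complex.exp (Complex.I * ((-inner ℝ y (k - k') : ℝ) : ℂ)) - 1) := by
    rw [mul_sub, ← Complex.exp_add, mul_one, inner_sub_right]
    congr 2
    push_cast
    ring
  rw [h4, norm_mul, norm_phase, one_mul]
  refine Real.norm_exp_I_mul_ofReal_sub_one_le.trans ?_
  rw [norm_neg]
  exact (norm_inner_le_norm y (k - k')).trans
    (mul_le_mul_of_nonneg_right (norm_le_of_mem_cell γ hy) (norm_nonneg _))

lemma continuous_phase {d : ℕ} (γ : Module.Basis (Fin d) ℝ (Space d)) (f : FiberSpace γ) :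
    Continuous fun k => phase γ k f := by
  refine LipschitzWith.continuous (K := Real.toNNReal ((∑ l, ‖γ l‖) * ‖f‖)) ?_
  refine LipschitzWith.of_dist_le_mul fun k k' => ?_
  rw [dist_eq_norm, dist_eq_norm, Real.coe_toNNReal _ (by positivity)]
  refine (norm_phase_sub_le γ k k' f).trans (le_of_eq ?_)
  ring

lemma memLp_zakSection {d : ℕ} (γ : Module.Basis (Fin d) ℝ (Space d)) (a : Space d)
    (ψ : L2 d) : MemLp (zakSection γ a ψ) 2 (brillouinMeasure γ) := by
  refine MemLp.of_bound (Continuous.aestronglyMeasurable ?_) ‖shiftRestrict γ a ψ‖ ?_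
  · unfold zakSection
    have h1 : Continuous fun k : Space d =>
        Complex.exp (Complex.I * ((-inner ℝ a k : ℝ) : ℂ)) := by fun_prop
    exact h1.smul (continuous_phase γ _)
  · filter_upwards with k
    rw [zakSection, norm_smul, norm_phase, one_mul]
    simpa using norm_phase_apply_le γ k (shiftRestrict γ a ψ)

/-- The Bloch-Floquet-Zak transform
`(𝒵ψ)(k,y) = ∑_{a ∈ Γ} exp(-i (y + a)·k) ψ(y + a)`. The terms are pairwise orthogonal in
`L²(Y*; H_f)` with square norms summing to `‖ψ‖²`, and the series converges in that space. -/
def zak {d : ℕ} (γ : Module.Basis (Fin d) ℝ (Space d)) (ψ : L2 d) : ZakSpace γ :=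
  ∑' a : lattice γ, (memLp_zakSection γ (a : Space d) ψ).toLp _

/-! ### Unbounded operators -/

section Operators

variable {𝓗 : Type} [NormedAddCommGroup 𝓗] [InnerProductSpace ℂ 𝓗]

/-- `R = (A - z)⁻¹` as a bounded everywhere defined operator. -/
def IsResolvent (A : 𝓗 →ₗ.[ℂ] 𝓗) (z : ℂ) (R : 𝓗 →L[ℂ] 𝓗) : Prop :=
  (∀ f, (R f, f + z • R f) ∈ A.graph) ∧ ∀ f g, (f, g) ∈ A.graph → R (g - z • f) = f

/-- The spectrum of an unbounded operator: complement of the resolvent set. -/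
def pspectrum (A : 𝓗 →ₗ.[ℂ] 𝓗) : Set ℂ := {z | ¬ ∃ R : 𝓗 →L[ℂ] 𝓗, IsResolvent A z R}

/-- The eigenspace of an unbounded operator. -/
def eigenspace (A : 𝓗 →ₗ.[ℂ] 𝓗) (z : ℂ) : Submodule ℂ 𝓗 where
  carrier := {f | (f, z • f) ∈ A.graph}
  add_mem' {f g} hf hg := by
    have h := A.graph.add_mem hf hg
    rwa [Prod.mk_add_mk, ← smul_add] at h
  zero_mem' := by
    change ((0 : 𝓗), z • (0 : 𝓗)) ∈ A.graph
    rw [smul_zero]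
    exact A.graph.zero_mem
  smul_mem' c f hf := by
    have h := A.graph.smul_mem c hf
    rwa [Prod.smul_mk, smul_comm] at h

/-- The orthogonal projection onto an eigenspace (closed already if `A` is self-adjoint). -/
def eigenprojection [CompleteSpace 𝓗] (A : 𝓗 →ₗ.[ℂ] 𝓗) (z : ℂ) : 𝓗 →L[ℂ] 𝓗 :=
  (eigenspace A z).topologicalClosure.starProjection

/-- A projection-valued measure on the Borel sets of `ℝ`. -/
structure ProjMeasure (𝓗 : Type) [NormedAddCommGroup 𝓗] [InnerProductSpace ℂ 𝓗]
    [CompleteSpace 𝓗] where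
  /-- the projection attached to a Borel set -/
  proj : Set ℝ → 𝓗 →L[ℂ] 𝓗
  isStarProjection : ∀ S, MeasurableSet S → IsStarProjection (proj S)
  proj_univ : proj Set.univ = 1
  proj_inter : ∀ S T, MeasurableSet S → MeasurableSet T → proj (S ∩ T) = proj S * proj T
  hasSum_proj : ∀ S : ℕ → Set ℝ, (∀ n, MeasurableSet (S n)) →
    Pairwise (Function.onFun Disjoint S) →
    ∀ f, HasSum (fun n => proj (S n) f) (proj (⋃ n, S n) f)

/-- `A = ∫ λ dΠ(λ)`: with `μ_f = ⟨f, Π(·) f⟩`, the domain of `A` consists of the `f` with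
`∫ λ² dμ_f < ∞`, and `⟨f, A f⟩ = ∫ λ dμ_f` there. -/
def ProjMeasure.Represents [CompleteSpace 𝓗] (Q : ProjMeasure 𝓗) (A : 𝓗 →ₗ.[ℂ] 𝓗) : Prop :=
  ∀ f : 𝓗, ∃ μ : Measure ℝ,
    (∀ S, MeasurableSet S → μ S = ENNReal.ofReal (‖Q.proj S f‖ ^ 2)) ∧
    (f ∈ A.domain ↔ Integrable (fun x : ℝ => x ^ 2) μ) ∧
    ∀ g, (f, g) ∈ A.graph → inner ℂ f g = ((∫ x, x ∂μ : ℝ) : ℂ)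

/-- `B = 𝟏_S(A)` for self-adjoint `A`: the value on `S` of the spectral measure of `A`. -/
def IsSpectralProjection [CompleteSpace 𝓗] (A : 𝓗 →ₗ.[ℂ] 𝓗) (S : Set ℝ) (B : 𝓗 →L[ℂ] 𝓗) :
    Prop :=
  ∃ Q : ProjMeasure 𝓗, Q.Represents A ∧ B = Q.proj S

/-- `e 0 ≤ e 1 ≤ …` are the eigenvalues of `A`, repeated according to multiplicity, and there is
an orthonormal basis of corresponding eigenvectors. -/
def IsEigenvalueEnumeration (A : 𝓗 →ₗ.[ℂ] 𝓗) (e : ℕ → ℝ) : Prop :=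
  Monotone e ∧ ∃ φ : HilbertBasis ℕ ℂ 𝓗, ∀ n, (φ n, (e n : ℂ) • φ n) ∈ A.graph

/-- `A` is trace class with trace `z`: for every orthonormal basis the diagonal series converges
unconditionally to `z`. -/
def HasTrace (A : 𝓗 →L[ℂ] 𝓗) (z : ℂ) : Prop :=
  ∀ (ι : Type) (b : HilbertBasis ι ℂ 𝓗), HasSum (fun i => inner ℂ (b i) (A (b i))) z

/-- Trace class operators. -/
def IsTraceClass (A : 𝓗 →L[ℂ] 𝓗) : Prop := ∃ z, HasTrace A z

open Classical in
/-- The trace of a trace class operator. -/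
def trace (A : 𝓗 →L[ℂ] 𝓗) : ℂ := if h : IsTraceClass A then h.choose else 0

end Operators

/-! ### Fibered operators and the projectors -/

/-- `A` commutes with complex conjugation `ψ ↦ ψ̄` on `L²(ℝ^d)`. -/
def CommutesWithConj {d : ℕ} (A : L2 d →ₗ.[ℂ] L2 d) : Prop :=
  ∀ ψ χ, (ψ, χ) ∈ A.graph → (star ψ, star χ) ∈ A.graph

/-- `𝒵 A 𝒵⁻¹ = ∫^⊕_{Y*} h(k) dk` as unbounded operators: the graph of `𝒵 A 𝒵⁻¹` consists of the
pairs `(Φ, Ξ)` in `L²(Y*; H_f)` with `Φ(k)` in the domain of `h(k)` and `h(k) Φ(k) = Ξ(k)` for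
almost every `k`. -/
def IsFiberDecomposition {d : ℕ} (γ : Module.Basis (Fin d) ℝ (Space d)) (A : L2 d →ₗ.[ℂ] L2 d)
    (h : Space d → FiberSpace γ →ₗ.[ℂ] FiberSpace γ) : Prop :=
  (fun p : L2 d × L2 d => (zak γ p.1, zak γ p.2)) '' (A.graph : Set (L2 d × L2 d)) =
    {p : ZakSpace γ × ZakSpace γ | ∀ᵐ k ∂(brillouinMeasure γ), (p.1 k, p.2 k) ∈ (h k).graph}

/-- `𝒵 A 𝒵⁻¹` is continuously fibered, with self-adjoint fibres `h(k)`, `k ∈ ℝ^d`, that are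
continuous in the (strong) resolvent sense and equivariant,
`h(k + κ) = exp(-i y·κ) h(k) exp(i y·κ)` for `κ` in the dual lattice. -/
structure IsContinuouslyFibered {d : ℕ} (γ : Module.Basis (Fin d) ℝ (Space d))
    (A : L2 d →ₗ.[ℂ] L2 d) (h : Space d → FiberSpace γ →ₗ.[ℂ] FiberSpace γ) : Prop where
  decomposition : IsFiberDecomposition γ A h
  selfAdjoint : ∀ k, IsSelfAdjoint (h k)
  continuous : ∃ R : Space d → FiberSpace γ →L[ℂ] FiberSpace γ,
    (∀ k, IsResolvent (h k) Complex.I (R k)) ∧ ∀ f, Continuous fun k => R k f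
  equivariant : ∀ k, ∀ κ ∈ lattice (dual γ), ∀ f g, (f, g) ∈ (h k).graph →
    (phase γ κ f, phase γ κ g) ∈ (h (k + κ)).graph

/-- Case (a): `E(t)` is in the resolvent set of `H(t)` and
`P(k,t) = 𝟏_{(-∞,E(t))}(H(k,t))` for all `k` and all `t ∈ I`. -/
def IsFermiProjector {d : ℕ} (γ : Module.Basis (Fin d) ℝ (Space d)) (I : Set ℝ)
    (H : ℝ → L2 d →ₗ.[ℂ] L2 d) (h : Space d → ℝ → FiberSpace γ →ₗ.[ℂ] FiberSpace γ)
    (P : Space d → ℝ → FiberSpace γ →L[ℂ] FiberSpace γ) : Prop :=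
  ∃ E : ℝ → ℝ, ∀ t ∈ I, (E t : ℂ) ∉ pspectrum (H t) ∧
    ∀ k, IsSpectralProjection (h k t) (Set.Iio (E t)) (P k t)

/-- Case (b): `P(k,t)` is the eigenprojector of the `m`-th Bloch band `E_m(k,t)`, which is
isolated: it keeps a positive distance, uniform in `k`, to the rest of the spectrum. -/
def IsBlochProjector {d : ℕ} (γ : Module.Basis (Fin d) ℝ (Space d)) (I : Set ℝ)
    (h : Space d → ℝ → FiberSpace γ →ₗ.[ℂ] FiberSpace γ)
    (P : Space d → ℝ → FiberSpace γ →L[ℂ] FiberSpace γ) : Prop :=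
  ∃ (e : Space d → ℝ → ℕ → ℝ) (m : ℕ), ∀ t ∈ I,
    (∀ k, IsEigenvalueEnumeration (h k t) (e k t)) ∧
    (∃ g > 0, ∀ k, ∀ z ∈ pspectrum (h k t), z ≠ (e k t m : ℂ) → g ≤ ‖z - (e k t m : ℂ)‖) ∧
    ∀ k, P k t = eigenprojection (h k t) (e k t m : ℂ)

/-! ### The piezocurvature -/

/-- `∂P/∂k_j`. -/
def dk {d : ℕ} {γ : Module.Basis (Fin d) ℝ (Space d)}
    (P : Space d → ℝ → FiberSpace γ →L[ℂ] FiberSpace γ) (j : Fin d) (k : Space d) (t : ℝ) :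
    FiberSpace γ →L[ℂ] FiberSpace γ :=
  fderiv ℝ (fun q => P q t) k (EuclideanSpace.single j 1)

/-- `∂P/∂t`, for `t` in the time interval `I`. -/
def dt {d : ℕ} {γ : Module.Basis (Fin d) ℝ (Space d)} (I : Set ℝ)
    (P : Space d → ℝ → FiberSpace γ →L[ℂ] FiberSpace γ) (k : Space d) (t : ℝ) :
    FiberSpace γ →L[ℂ] FiberSpace γ :=
  derivWithin (fun s => P k s) I t

/-- The operator `P [∂_t P, ∂_j P]`. -/
def curvatureOp {d : ℕ} {γ : Module.Basis (Fin d) ℝ (Space d)} (I : Set ℝ)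
    (P : Space d → ℝ → FiberSpace γ →L[ℂ] FiberSpace γ) (j : Fin d) (k : Space d) (t : ℝ) :
    FiberSpace γ →L[ℂ] FiberSpace γ :=
  P k t * (dt I P k t * dk P j k t - dk P j k t * dt I P k t)

/-- The piezocurvature `Θ = -i tr(P [∂_t P, ∇_k P])`, a vector with `d` components. -/
def piezocurvature {d : ℕ} {γ : Module.Basis (Fin d) ℝ (Space d)} (I : Set ℝ)
    (P : Space d → ℝ → FiberSpace γ →L[ℂ] FiberSpace γ) (k : Space d) (t : ℝ) : Fin d → ℂ :=
  fun j => -Complex.I * trace (curvatureOp I P j k t)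

/-- The derivatives and the traces in the definition of `Θ(k,t)` exist. -/
structure PiezocurvatureExists {d : ℕ} {γ : Module.Basis (Fin d) ℝ (Space d)} (I : Set ℝ)
    (P : Space d → ℝ → FiberSpace γ →L[ℂ] FiberSpace γ) (k : Space d) (t : ℝ) : Prop where
  differentiable_k : DifferentiableAt ℝ (fun q => P q t) k
  differentiable_t : DifferentiableWithinAt ℝ (fun s => P k s) I t
  traceClass : ∀ j, IsTraceClass (curvatureOp I P j k t)

end Piezo

end

/-!
Complex conjugation commutes with `H`, and the Bloch-Floquet-Zak transform turns it into the map
`Φ ↦ (k ↦ conj Φ(-k))`. Applied to the constant sections `f`, whose images `k ↦ (h(k) - i)⁻¹ f`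
under the resolvent are continuous, this shows that conjugation `J` carries `h(k)` to `h(-k)` for
almost every `k` in the cell; by continuity it does so for every `k` in the cell, and by
equivariance for every `k`.

A self-adjoint operator determines its spectral measure and its ordered list of eigenvalues, so
conjugation by the antiunitary `J` carries the spectral projections and the eigenprojections of
`h(k)` to those of `h(-k)`: `P(-k) = J P(k) J⁻¹`.

In the curvature operator `X = P [∂ₜP, ∂ₖP]` the derivative `∂ₖ` changes sign under `k ↦ -k`, so
`X(-k) = -J X(k) J⁻¹`, and the trace of `J X J⁻¹` is the conjugate of that of `X`. The derivatives
of a family of projections are off-diagonal with respect to `P`, that is `P' = P P' + P' P`, which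
makes `X` anti-self-adjoint and its trace imaginary: the two signs cancel.
-/

noncomputable section

namespace Piezo

section SelfAdjoint

variable {𝕜 : Type*} [RCLike 𝕜] {𝓗 : Type*} [NormedAddCommGroup 𝓗] [InnerProductSpace 𝕜 𝓗]
  [CompleteSpace 𝓗] {A : 𝓗 →ₗ.[𝕜] 𝓗}

lemma mem_graph_iff_of_isSelfAdjoint (hA : IsSelfAdjoint A) {f g : 𝓗} :
    (f, g) ∈ A.graph ↔ ∀ x y, (x, y) ∈ A.graph → inner 𝕜 y f = inner 𝕜 x g := by
  have h := LinearPMap.adjoint_graph_eq_graph_adjoint hA.dense_domain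
  rw [LinearPMap.isSelfAdjoint_def.mp hA] at h
  conv_lhs => rw [h]
  simp only [Submodule.mem_adjoint_iff, sub_eq_zero]

lemma inner_comm_of_mem_graph (hA : IsSelfAdjoint A) {f g x y : 𝓗}
    (hf : (f, g) ∈ A.graph) (hx : (x, y) ∈ A.graph) : inner 𝕜 y f = inner 𝕜 x g :=
  (mem_graph_iff_of_isSelfAdjoint hA).mp hf x y hx

/-- The commutant of a self-adjoint operator `A`: the bounded operators `T` with `T A ⊆ A T`, that
is, those that map the graph of `A` into itself. -/
def commutant (hA : IsSelfAdjoint A) : StarSubalgebra 𝕜 (𝓗 →L[𝕜] 𝓗) where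
  carrier := {T | ∀ f g, (f, g) ∈ A.graph → (T f, T g) ∈ A.graph}
  mul_mem' hS hT f g hfg := hS _ _ (hT f g hfg)
  add_mem' hS hT f g hfg := A.graph.add_mem (hS f g hfg) (hT f g hfg)
  algebraMap_mem' c f g hfg := by
    simpa [Algebra.algebraMap_eq_smul_one] using A.graph.smul_mem c hfg
  star_mem' {T} hT f g hfg := by
    refine (mem_graph_iff_of_isSelfAdjoint hA).mpr fun x y hxy => ?_
    simpa only [ContinuousLinearMap.star_eq_adjoint, ContinuousLinearMap.adjoint_inner_right]
      using inner_comm_of_mem_graph hA hfg (hT x y hxy)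

lemma mem_commutant_iff (hA : IsSelfAdjoint A) {T : 𝓗 →L[𝕜] 𝓗} :
    T ∈ commutant hA ↔ ∀ f g, (f, g) ∈ A.graph → (T f, T g) ∈ A.graph :=
  Iff.rfl

lemma isClosed_commutant (hA : IsSelfAdjoint A) :
    IsClosed (commutant hA : Set (𝓗 →L[𝕜] 𝓗)) := by
  have h : (commutant hA : Set (𝓗 →L[𝕜] 𝓗)) =
      ⋂ p ∈ A.graph, (fun T : 𝓗 →L[𝕜] 𝓗 => (T p.1, T p.2)) ⁻¹' A.graph := by
    ext T
    simp only [SetLike.mem_coe, mem_commutant_iff, Set.mem_iInter, Set.mem_preimage, Prod.forall]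
  rw [h]
  exact isClosed_biInter fun p _ => hA.isClosed.preimage (by fun_prop)

end SelfAdjoint

section AbsoluteValue

variable {𝓗 : Type*} [NormedAddCommGroup 𝓗] [InnerProductSpace ℂ 𝓗] [CompleteSpace 𝓗]

lemma abs_mem_commutant {A : 𝓗 →ₗ.[ℂ] 𝓗} (hA : IsSelfAdjoint A) {T : 𝓗 →L[ℂ] 𝓗}
    (hT : T ∈ commutant hA) : CFC.abs T ∈ commutant hA := by
  have := isClosed_commutant hA
  rw [CFC.abs, CFC.sqrt_eq_real_sqrt _ (star_mul_self_nonneg T)]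
  exact cfcₙ_mem (𝕜' := ℂ) _ (mul_mem (star_mem hT) hT)

lemma inner_abs_abs (T : 𝓗 →L[ℂ] 𝓗) (f g : 𝓗) :
    inner ℂ (CFC.abs T f) (CFC.abs T g) = inner ℂ (T f) (T g) := by
  rw [← ContinuousLinearMap.adjoint_inner_right, ← ContinuousLinearMap.adjoint_inner_right T,
    ← ContinuousLinearMap.star_eq_adjoint, ← ContinuousLinearMap.star_eq_adjoint,
    (CFC.abs_nonneg T).isSelfAdjoint.star_eq, ← mul_apply_eq_comp,
    ← mul_apply_eq_comp, CFC.abs_mul_abs]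

lemma norm_abs_apply (T : 𝓗 →L[ℂ] 𝓗) (f : 𝓗) : ‖CFC.abs T f‖ = ‖T f‖ := by
  rw [@norm_eq_sqrt_re_inner ℂ, @norm_eq_sqrt_re_inner ℂ _ _ _ _ (T f), inner_abs_abs]

lemma mul_abs_eq_abs {T p : 𝓗 →L[ℂ] 𝓗} (hp : IsSelfAdjoint p) (hT : T * p = T) :
    p * CFC.abs T = CFC.abs T := by
  have h : CFC.abs T * p = CFC.abs T := by
    ext1 f
    rw [← sub_eq_zero, mul_apply_eq_comp, ← map_sub, ← norm_eq_zero, norm_abs_apply,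
      map_sub, ← mul_apply_eq_comp, hT, sub_self, norm_zero]
  simpa only [star_mul, hp.star_eq, (CFC.abs_nonneg T).isSelfAdjoint.star_eq] using congrArg star h

end AbsoluteValue

namespace ProjMeasure

variable {𝓗 : Type} [NormedAddCommGroup 𝓗] [InnerProductSpace ℂ 𝓗] [CompleteSpace 𝓗]

section Projections

variable (Q : ProjMeasure 𝓗) {S : Set ℝ}

lemma proj_empty : Q.proj ∅ = 0 := by
  ext1 f
  have h := (Q.hasSum_proj (fun _ => ∅) (fun _ => MeasurableSet.empty)
    (fun _ _ _ => disjoint_bot_left) f).summable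
  exact tendsto_nhds_unique tendsto_const_nhds h.tendsto_atTop_zero

lemma proj_compl (hS : MeasurableSet S) : Q.proj Sᶜ = 1 - Q.proj S := by
  rw [eq_sub_iff_add_eq', ← Q.proj_univ, ← Set.union_compl_self S]
  ext1 f
  let T : ℕ → Set ℝ := fun n => if n = 0 then S else if n = 1 then Sᶜ else ∅
  have hT : ⋃ n, T n = S ∪ Sᶜ := by
    ext x
    have h : ∃ n, x ∈ T n := by
      by_cases hx : x ∈ S
      · exact ⟨0, by simpa [T] using hx⟩
      · exact ⟨1, by simpa [T] using hx⟩
    simpa [Set.mem_iUnion, em] using h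
  have hsum := Q.hasSum_proj T (fun n => by dsimp only [T]; split_ifs <;> simp [hS])
    (fun m n hmn => by
      dsimp only [T, Function.onFun]
      split_ifs <;> simp_all [disjoint_compl_right, disjoint_compl_left]) f
  have hfin := hasSum_sum_of_ne_finset_zero (L := .unconditional ℕ) (s := Finset.range 2)
    (f := fun n => Q.proj (T n) f) fun n hn => by
      have hn : 1 < n := by simpa using hn
      simp [T, show n ≠ 0 by lia, show n ≠ 1 by lia, Q.proj_empty]
  rw [hT] at hsum
  simpa [T, Finset.sum_range_succ] using hfin.unique hsum

lemma proj_proj_apply (hS : MeasurableSet S) (f : 𝓗) : Q.proj S (Q.proj S f) = Q.proj S f :=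
  DFunLike.congr_fun (Q.isStarProjection S hS).isIdempotentElem.eq f

lemma proj_compl_apply_eq_zero_iff (hS : MeasurableSet S) {f : 𝓗} :
    Q.proj Sᶜ f = 0 ↔ Q.proj S f = f := by
  rw [Q.proj_compl hS, _root_.sub_apply, one_apply_eq_self, sub_eq_zero, eq_comm]

lemma proj_compl_apply_eq_self_iff (hS : MeasurableSet S) {f : 𝓗} :
    Q.proj Sᶜ f = f ↔ Q.proj S f = 0 := by
  rw [← Q.proj_compl_apply_eq_zero_iff hS.compl, compl_compl]

lemma inner_proj_left (hS : MeasurableSet S) (f g : 𝓗) :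
    inner ℂ (Q.proj S f) g = inner ℂ f (Q.proj S g) :=
  ContinuousLinearMap.isSelfAdjoint_iff_isSymmetric.mp (Q.isStarProjection S hS).isSelfAdjoint f g

lemma inner_proj_self (hS : MeasurableSet S) (f : 𝓗) :
    inner ℂ (Q.proj S f) f = (‖Q.proj S f‖ : ℂ) ^ 2 := by
  rw [← Q.proj_proj_apply hS, Q.inner_proj_left hS, Q.proj_proj_apply hS,
    inner_self_eq_norm_sq_to_K]
  rfl

end Projections

section ScalarMeasure

/-- `μ` is the scalar spectral measure `⟨f, Q(·) f⟩` of `Q` at `f`. -/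
def IsScalarMeasure (Q : ProjMeasure 𝓗) (f : 𝓗) (μ : Measure ℝ) : Prop :=
  ∀ S, MeasurableSet S → μ S = ENNReal.ofReal (‖Q.proj S f‖ ^ 2)

variable {Q : ProjMeasure 𝓗} {f : 𝓗} {S : Set ℝ} {μ ν : Measure ℝ}

lemma IsScalarMeasure.measure_univ (h : Q.IsScalarMeasure f μ) :
    μ Set.univ = ENNReal.ofReal (‖f‖ ^ 2) := by
  rw [h _ MeasurableSet.univ, Q.proj_univ, one_apply_eq_self]

lemma IsScalarMeasure.isFiniteMeasure (h : Q.IsScalarMeasure f μ) : IsFiniteMeasure μ :=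
  ⟨h.measure_univ ▸ ENNReal.ofReal_lt_top⟩

lemma IsScalarMeasure.integral_const (h : Q.IsScalarMeasure f μ) (a : ℝ) :
    ∫ _, a ∂μ = a * ‖f‖ ^ 2 := by
  rw [MeasureTheory.integral_const, measureReal_def, h.measure_univ,
    ENNReal.toReal_ofReal (by positivity), smul_eq_mul, mul_comm]

lemma IsScalarMeasure.eq_restrict (h : Q.IsScalarMeasure f μ) (hS : MeasurableSet S)
    (hν : Q.IsScalarMeasure (Q.proj S f) ν) : ν = μ.restrict S := by
  ext T hT
  rw [hν T hT, Measure.restrict_apply hT, h _ (hT.inter hS), Q.proj_inter T S hT hS,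
    mul_apply_eq_comp]

lemma IsScalarMeasure.ae_mem (h : Q.IsScalarMeasure f μ) (hS : MeasurableSet S)
    (hf : Q.proj S f = f) : ∀ᵐ x ∂μ, x ∈ S := by
  rw [ae_iff]
  change μ Sᶜ = 0
  rw [h _ hS.compl, (Q.proj_compl_apply_eq_zero_iff hS).mpr hf, norm_zero, zero_pow two_ne_zero,
    ENNReal.ofReal_zero]

end ScalarMeasure

namespace Represents

variable {A : 𝓗 →ₗ.[ℂ] 𝓗} {Q Q' : ProjMeasure 𝓗} {S : Set ℝ} {a : ℝ} {f f' g g' : 𝓗}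

lemma exists_integral (hQ : Q.Represents A) (hf : (f, f') ∈ A.graph) :
    ∃ μ, IsFiniteMeasure μ ∧ Q.IsScalarMeasure f μ ∧ Integrable (fun x : ℝ => x) μ ∧
      inner ℂ f f' = ((∫ x, x ∂μ : ℝ) : ℂ) := by
  obtain ⟨μ, hμ, hdom, hint⟩ := hQ f
  have hfin : IsFiniteMeasure μ := IsScalarMeasure.isFiniteMeasure hμ
  have hsq : MemLp (fun x : ℝ => x) 2 μ :=
    (memLp_two_iff_integrable_sq measurable_id.aestronglyMeasurable).mpr
      (hdom.mp (LinearPMap.mem_domain_of_mem_graph hf))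
  exact ⟨μ, hfin, hμ, hsq.integrable one_le_two, hint f' hf⟩

lemma re_inner_le (hQ : Q.Represents A) (hf : Q.proj (Set.Iic a) f = f)
    (hff' : (f, f') ∈ A.graph) : (inner ℂ f f').re ≤ a * ‖f‖ ^ 2 := by
  obtain ⟨μ, hfin, hμ, hint, hinner⟩ := hQ.exists_integral hff'
  rw [hinner, Complex.ofReal_re, ← hμ.integral_const]
  exact integral_mono_ae hint (integrable_const a) (hμ.ae_mem measurableSet_Iic hf)

lemma lt_re_inner (hQ : Q.Represents A) (hf : Q.proj (Set.Ioi a) f = f) (hf0 : f ≠ 0)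
    (hff' : (f, f') ∈ A.graph) : a * ‖f‖ ^ 2 < (inner ℂ f f').re := by
  obtain ⟨μ, hfin, hμ, hint, hinner⟩ := hQ.exists_integral hff'
  have hmem : ∀ᵐ x ∂μ, a < x := hμ.ae_mem measurableSet_Ioi hf
  have hμ0 : μ ≠ 0 := by
    rw [← Measure.measure_univ_ne_zero, hμ.measure_univ]
    simpa using hf0
  rw [hinner, Complex.ofReal_re, ← hμ.integral_const, ← sub_pos,
    ← integral_sub hint (integrable_const a), integral_pos_iff_support_of_nonneg_ae
      (hmem.mono fun x hx => (sub_pos.mpr hx).le) (hint.sub (integrable_const a))]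
  refine pos_iff_ne_zero.mpr fun hsupp => hμ0 (ae_eq_bot.mp (Filter.empty_mem_iff_bot.mp ?_))
  filter_upwards [hmem, compl_mem_ae_iff.mpr hsupp] with x hx hx'
  exact hx' (sub_pos.mpr hx).ne'

lemma proj_mem_domain (hQ : Q.Represents A) (hS : MeasurableSet S) (hf : f ∈ A.domain) :
    Q.proj S f ∈ A.domain := by
  obtain ⟨μ, hμ, hdom, -⟩ := hQ f
  obtain ⟨ν, hν, hdom', -⟩ := hQ (Q.proj S f)
  rw [hdom', IsScalarMeasure.eq_restrict hμ hS hν]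
  exact (hdom.mp hf).integrableOn

lemma inner_add_add (hQ : Q.Represents A) (hS : MeasurableSet S) (hf : Q.proj S f = f)
    (hg : Q.proj S g = 0) (hff' : (f, f') ∈ A.graph) (hgg' : (g, g') ∈ A.graph) :
    inner ℂ (f + g) (f' + g') = inner ℂ f f' + inner ℂ g g' := by
  obtain ⟨μ, -, hμ, hint, hinner⟩ := hQ.exists_integral (A.graph.add_mem hff' hgg')
  obtain ⟨μf, -, hμf, -, hinnerf⟩ := hQ.exists_integral hff'
  obtain ⟨μg, -, hμg, -, hinnerg⟩ := hQ.exists_integral hgg'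
  have hprojf : Q.proj S (f + g) = f := by rw [map_add, hf, hg, add_zero]
  have hprojg : Q.proj Sᶜ (f + g) = g := by
    rw [map_add, (Q.proj_compl_apply_eq_zero_iff hS).mpr hf,
      (Q.proj_compl_apply_eq_self_iff hS).mpr hg, zero_add]
  have hrestrictf : μf = μ.restrict S := hμ.eq_restrict hS (hprojf.symm ▸ hμf)
  have hrestrictg : μg = μ.restrict Sᶜ := hμ.eq_restrict hS.compl (hprojg.symm ▸ hμg)
  change inner ℂ (f + g) (f' + g') = _ at hinner
  rw [hinner, hinnerf, hinnerg, hrestrictf, hrestrictg, ← Complex.ofReal_add,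
    integral_add_compl hS hint]

lemma inner_eq_zero (hQ : Q.Represents A) (hS : MeasurableSet S) (hf : Q.proj S f = f)
    (hg : Q.proj S g = 0) (hff' : (f, f') ∈ A.graph) (hgg' : (g, g') ∈ A.graph) :
    inner ℂ g f' = 0 := by
  have hpolar (c : ℂ) : c * inner ℂ g f' + starRingEnd ℂ c * inner ℂ f g' = 0 := by
    have h := hQ.inner_add_add hS (f := c • f) (by rw [map_smul, hf]) hg
      (A.graph.smul_mem c hff') hgg'
    change inner ℂ (c • f + g) (c • f' + g') = inner ℂ (c • f) (c • f') + inner ℂ g g' at h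
    rw [inner_add_left, inner_add_right, inner_add_right, inner_smul_right g f' c,
      inner_smul_left f g' c] at h
    linear_combination h
  have h1 := hpolar 1
  have hI := hpolar Complex.I
  rw [map_one] at h1
  rw [Complex.conj_I] at hI
  have h : (2 * Complex.I) * inner ℂ g f' = 0 := by linear_combination hI + Complex.I * h1
  simpa using h

lemma proj_apply_eq_self (hQ : Q.Represents A) (hA : Dense (A.domain : Set 𝓗))
    (hS : MeasurableSet S) (hf : Q.proj S f = f) (hff' : (f, f') ∈ A.graph) :
    Q.proj S f' = f' := by
  refine hA.eq_of_inner_right ℂ fun u hu => ?_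
  obtain ⟨v, hv⟩ := LinearPMap.mem_domain_iff.mp
    (A.domain.sub_mem hu (hQ.proj_mem_domain hS hu))
  have h := hQ.inner_eq_zero hS hf (by rw [map_sub, Q.proj_proj_apply hS, sub_self]) hff' hv
  rw [inner_sub_left, Q.inner_proj_left hS, sub_eq_zero] at h
  exact h.symm

lemma proj_mem_commutant (hQ : Q.Represents A) (hA : IsSelfAdjoint A) (hS : MeasurableSet S) :
    Q.proj S ∈ commutant hA := by
  intro f f' hff'
  obtain ⟨g, hg⟩ := LinearPMap.mem_domain_iff.mp
    (hQ.proj_mem_domain hS (LinearPMap.mem_domain_of_mem_graph hff'))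
  have hS_g : Q.proj S g = g :=
    hQ.proj_apply_eq_self hA.dense_domain hS (Q.proj_proj_apply hS f) hg
  have hcompl : Q.proj Sᶜ (f' - g) = f' - g :=
    hQ.proj_apply_eq_self hA.dense_domain hS.compl
      ((Q.proj_compl_apply_eq_self_iff hS).mpr (by rw [map_sub, Q.proj_proj_apply hS, sub_self]))
      (A.graph.sub_mem hff' hg)
  rw [Q.proj_compl_apply_eq_self_iff hS, map_sub, hS_g, sub_eq_zero] at hcompl
  rwa [hcompl]

/-- With `X = Q(a,∞) Q'(-∞,a]`, the operator `|X|` commutes with `A` and takes its values in the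
range of `Q'(-∞,a]`, so that `⟨X f, A X f⟩ = ⟨|X| f, A |X| f⟩ ≤ a ‖|X| f‖² = a ‖X f‖²`. -/
lemma proj_Ioi_mul_proj_Iic (hQ : Q.Represents A) (hQ' : Q'.Represents A) (hA : IsSelfAdjoint A)
    (a : ℝ) : Q.proj (Set.Ioi a) * Q'.proj (Set.Iic a) = 0 := by
  set p := Q.proj (Set.Ioi a)
  set p' := Q'.proj (Set.Iic a)
  have hp' : IsStarProjection p' := Q'.isStarProjection _ measurableSet_Iic
  set X := p * p'
  have hX : X ∈ commutant hA := mul_mem (hQ.proj_mem_commutant hA measurableSet_Ioi)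
    (hQ'.proj_mem_commutant hA measurableSet_Iic)
  have hrange : p' * CFC.abs X = CFC.abs X :=
    mul_abs_eq_abs hp'.isSelfAdjoint (by rw [mul_assoc, hp'.isIdempotentElem.eq])
  have hzero : ∀ f ∈ A.domain, X f = 0 := by
    intro f hf
    obtain ⟨g, hg⟩ := LinearPMap.mem_domain_iff.mp hf
    by_contra hXf
    have hpX : p (X f) = X f := Q.proj_proj_apply measurableSet_Ioi (p' f)
    refine (hQ.lt_re_inner hpX hXf (hX f g hg)).not_ge ?_
    rw [← inner_abs_abs, ← norm_abs_apply]
    exact hQ'.re_inner_le (DFunLike.congr_fun hrange f) (abs_mem_commutant hA hX f g hg)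
  ext1 f
  exact congrFun (X.continuous.ext_on hA.dense_domain continuous_const hzero) f

lemma proj_Iic_eq (hQ : Q.Represents A) (hQ' : Q'.Represents A) (hA : IsSelfAdjoint A) (a : ℝ) :
    Q.proj (Set.Iic a) = Q'.proj (Set.Iic a) := by
  have h := hQ.proj_Ioi_mul_proj_Iic hQ' hA a
  have h' := hQ'.proj_Ioi_mul_proj_Iic hQ hA a
  rw [← Set.compl_Iic, Q.proj_compl measurableSet_Iic, sub_mul, one_mul, sub_eq_zero] at h
  rw [← Set.compl_Iic, Q'.proj_compl measurableSet_Iic, sub_mul, one_mul, sub_eq_zero] at h'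
  rw [h']
  simpa only [star_mul, (Q.isStarProjection _ measurableSet_Iic).isSelfAdjoint.star_eq,
    (Q'.isStarProjection _ measurableSet_Iic).isSelfAdjoint.star_eq] using (congrArg star h).symm

theorem proj_eq (hQ : Q.Represents A) (hQ' : Q'.Represents A) (hA : IsSelfAdjoint A)
    (hS : MeasurableSet S) : Q.proj S = Q'.proj S := by
  have hnorm (f : 𝓗) : ‖Q.proj S f‖ = ‖Q'.proj S f‖ := by
    obtain ⟨μ, hμ, -, -⟩ := hQ f
    obtain ⟨ν, hν, -, -⟩ := hQ' f
    have hfin : IsFiniteMeasure μ := IsScalarMeasure.isFiniteMeasure hμ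
    have hμν : μ = ν := Measure.ext_of_Iic μ ν fun a => by
      rw [hμ _ measurableSet_Iic, hν _ measurableSet_Iic, hQ.proj_Iic_eq hQ' hA]
    have h := (hμ S hS).symm.trans (hμν ▸ hν S hS)
    rwa [ENNReal.ofReal_eq_ofReal_iff (by positivity) (by positivity),
      sq_eq_sq₀ (norm_nonneg _) (norm_nonneg _)] at h
  have h := (ext_inner_map (Q.proj S : 𝓗 →ₗ[ℂ] 𝓗) (Q'.proj S)).mp fun f => by
    simp only [ContinuousLinearMap.coe_coe, inner_proj_self _ hS, hnorm]
  exact ContinuousLinearMap.coe_inj.mp h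

end Represents

end ProjMeasure

section Antiunitary

variable {𝓗 𝓚 : Type*} [NormedAddCommGroup 𝓗] [InnerProductSpace ℂ 𝓗]
  [NormedAddCommGroup 𝓚] [InnerProductSpace ℂ 𝓚]

lemma re_inner_map_map {F : Type*} [FunLike F 𝓗 𝓚]
    [SemilinearIsometryClass F (starRingEnd ℂ) 𝓗 𝓚] (J : F) (f g : 𝓗) :
    (inner ℂ (J f) (J g)).re = (inner ℂ f g).re := by
  have h := norm_add_sq (𝕜 := ℂ) f g
  have hJ := norm_add_sq (𝕜 := ℂ) (J f) (J g)
  rw [← map_add, SemilinearIsometryClass.norm_map, SemilinearIsometryClass.norm_map,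
    SemilinearIsometryClass.norm_map] at hJ
  simp only [RCLike.re_to_complex] at h hJ
  linarith

lemma inner_map_map_of_antilinear {F : Type*} [FunLike F 𝓗 𝓚]
    [SemilinearIsometryClass F (starRingEnd ℂ) 𝓗 𝓚] (J : F) (f g : 𝓗) :
    inner ℂ (J f) (J g) = inner ℂ g f := by
  rw [← inner_conj_symm g f]
  apply Complex.ext
  · rw [re_inner_map_map, Complex.conj_re]
  · have h := re_inner_map_map J (Complex.I • f) g
    rw [map_smulₛₗ, inner_smul_left, inner_smul_left] at h
    simp only [Complex.conj_I, map_neg, neg_mul, Complex.neg_re, Complex.mul_re, Complex.I_re,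
      Complex.I_im, zero_mul, one_mul, zero_sub, neg_neg] at h
    rw [Complex.conj_im]
    linarith

variable (J : 𝓗 ≃ₗᵢ⋆[ℂ] 𝓚)

/-- The image of a Hilbert basis under an antiunitary operator. -/
def mapHilbertBasis {ι : Type*} [CompleteSpace 𝓚] (b : HilbertBasis ι ℂ 𝓗) :
    HilbertBasis ι ℂ 𝓚 :=
  HilbertBasis.mkOfOrthogonalEqBot (v := fun i => J (b i))
    (by
      classical
      rw [orthonormal_iff_ite]
      intro i j
      rw [inner_map_map_of_antilinear, orthonormal_iff_ite.mp b.orthonormal]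
      simp only [eq_comm])
    (by
      rw [Submodule.eq_bot_iff]
      intro f hf
      have h : J.symm f = 0 := by
        refine b.repr.injective ?_
        ext i
        rw [b.repr_apply_apply, map_zero, ← inner_map_map_of_antilinear J, J.apply_symm_apply]
        exact (Submodule.mem_orthogonal' _ _).mp hf _ (Submodule.subset_span ⟨i, rfl⟩)
      exact (map_eq_zero_iff J.symm J.symm.injective).mp h)

lemma mapHilbertBasis_apply {ι : Type*} [CompleteSpace 𝓚] (b : HilbertBasis ι ℂ 𝓗) (i : ι) :
    mapHilbertBasis J b i = J (b i) := by
  simp [mapHilbertBasis]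

variable [CompleteSpace 𝓗] [CompleteSpace 𝓚]

/-- The real star algebra isomorphism `T ↦ J T J⁻¹` for an antiunitary operator `J`. It is only
real linear, since it turns a scalar `c` into its conjugate. -/
def conjOp : (𝓗 →L[ℂ] 𝓗) ≃⋆ₐ[ℝ] (𝓚 →L[ℂ] 𝓚) where
  toFun T := (J.toContinuousLinearEquiv : 𝓗 →L⋆[ℂ] 𝓚).comp
    (T.comp (J.symm.toContinuousLinearEquiv : 𝓚 →L⋆[ℂ] 𝓗))
  invFun T := (J.symm.toContinuousLinearEquiv : 𝓚 →L⋆[ℂ] 𝓗).comp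
    (T.comp (J.toContinuousLinearEquiv : 𝓗 →L⋆[ℂ] 𝓚))
  left_inv T := by ext1 f; simp
  right_inv T := by ext1 f; simp
  map_mul' S T := by ext1 f; simp
  map_add' S T := by ext1 f; simp
  map_star' T := by
    rw [ContinuousLinearMap.star_eq_adjoint, ContinuousLinearMap.star_eq_adjoint,
      ContinuousLinearMap.eq_adjoint_iff]
    intro f g
    obtain ⟨f, rfl⟩ := J.surjective f
    obtain ⟨g, rfl⟩ := J.surjective g
    simp [inner_map_map_of_antilinear, ContinuousLinearMap.adjoint_inner_right]
  map_smul' c T := by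
    ext1 f
    change J ((c • T) (J.symm f)) = c • J (T (J.symm f))
    rw [_root_.smul_apply, ← Complex.coe_smul, ← Complex.coe_smul, map_smulₛₗ, Complex.conj_ofReal]

lemma conjOp_apply (T : 𝓗 →L[ℂ] 𝓗) (f : 𝓚) : conjOp J T f = J (T (J.symm f)) := rfl

lemma conjOp_neg (T : 𝓗 →L[ℂ] 𝓗) : conjOp J (-T) = -conjOp J T := map_neg (conjOp J) T

lemma conjOp_sub (S T : 𝓗 →L[ℂ] 𝓗) : conjOp J (S - T) = conjOp J S - conjOp J T :=
  map_sub (conjOp J) S T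

lemma norm_conjOp (T : 𝓗 →L[ℂ] 𝓗) : ‖conjOp J T‖ = ‖T‖ := by
  refine le_antisymm (ContinuousLinearMap.opNorm_le_bound _ (norm_nonneg _) fun f => ?_)
    (ContinuousLinearMap.opNorm_le_bound _ (norm_nonneg _) fun f => ?_)
  · rw [conjOp_apply, J.norm_map, ← J.symm.norm_map f]
    exact T.le_opNorm _
  · rw [← J.norm_map f, ← J.norm_map (T f)]
    simpa only [conjOp_apply, J.symm_apply_apply] using (conjOp J T).le_opNorm (J f)

/-- `conjOp` as a real linear isometry, the form in which it is differentiated. -/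
def conjOpₗᵢ : (𝓗 →L[ℂ] 𝓗) ≃ₗᵢ[ℝ] (𝓚 →L[ℂ] 𝓚) where
  toLinearEquiv := (conjOp J).toAlgEquiv.toLinearEquiv
  norm_map' := norm_conjOp J

end Antiunitary

section Trace

variable {𝓗 : Type} [NormedAddCommGroup 𝓗] [InnerProductSpace ℂ 𝓗]
  {𝓚 : Type} [NormedAddCommGroup 𝓚] [InnerProductSpace ℂ 𝓚]

lemma trace_congr {S : 𝓗 →L[ℂ] 𝓗} {T : 𝓚 →L[ℂ] 𝓚} (h : ∀ z, HasTrace S z ↔ HasTrace T z) :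
    trace S = trace T := by
  have : HasTrace S = HasTrace T := funext fun z => propext (h z)
  unfold trace IsTraceClass
  rw [this]

variable [CompleteSpace 𝓗] [CompleteSpace 𝓚]

lemma HasTrace.star {T : 𝓗 →L[ℂ] 𝓗} {z : ℂ} (h : HasTrace T z) :
    HasTrace (star T) (starRingEnd ℂ z) := by
  intro ι b
  have hconj := (h ι b).star
  simp only [Complex.star_def, inner_conj_symm] at hconj
  simpa only [ContinuousLinearMap.star_eq_adjoint, ContinuousLinearMap.adjoint_inner_right]
    using hconj

lemma HasTrace.conjOp {T : 𝓗 →L[ℂ] 𝓗} {z : ℂ} (h : HasTrace T z) (J : 𝓗 ≃ₗᵢ⋆[ℂ] 𝓚) :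
    HasTrace (conjOp J T) (starRingEnd ℂ z) := by
  intro ι b
  have hconj := (h ι (mapHilbertBasis J.symm b)).star
  simp only [mapHilbertBasis_apply, Complex.star_def, inner_conj_symm] at hconj
  refine hconj.congr_fun fun i => ?_
  nth_rw 1 [← J.apply_symm_apply (b i)]
  rw [conjOp_apply, inner_map_map_of_antilinear]

end Trace

section Transport

variable {𝓗 : Type} [NormedAddCommGroup 𝓗] [InnerProductSpace ℂ 𝓗]
  {𝓚 : Type} [NormedAddCommGroup 𝓚] [InnerProductSpace ℂ 𝓚]
  {A : 𝓗 →ₗ.[ℂ] 𝓗} {B : 𝓚 →ₗ.[ℂ] 𝓚} (J : 𝓗 ≃ₗᵢ⋆[ℂ] 𝓚)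

lemma map_mem_eigenspace_iff (hAB : ∀ f g, (J f, J g) ∈ B.graph ↔ (f, g) ∈ A.graph) {z : ℂ}
    {f : 𝓗} : J f ∈ eigenspace B (starRingEnd ℂ z) ↔ f ∈ eigenspace A z := by
  change (J f, starRingEnd ℂ z • J f) ∈ B.graph ↔ (f, z • f) ∈ A.graph
  rw [← hAB, map_smulₛₗ]

variable [CompleteSpace 𝓚]

lemma IsEigenvalueEnumeration.map (hAB : ∀ f g, (J f, J g) ∈ B.graph ↔ (f, g) ∈ A.graph)
    {e : ℕ → ℝ} (he : IsEigenvalueEnumeration A e) : IsEigenvalueEnumeration B e := by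
  obtain ⟨hmono, φ, hφ⟩ := he
  refine ⟨hmono, mapHilbertBasis J φ, fun n => ?_⟩
  have hJφ := (hAB _ _).mpr (hφ n)
  rwa [map_smulₛₗ, Complex.conj_ofReal, ← mapHilbertBasis_apply] at hJφ

variable [CompleteSpace 𝓗]

/-- The projection-valued measure `S ↦ J Q(S) J⁻¹`. -/
def ProjMeasure.map (Q : ProjMeasure 𝓗) : ProjMeasure 𝓚 where
  proj S := conjOp J (Q.proj S)
  isStarProjection S hS := (Q.isStarProjection S hS).map (conjOp J)
  proj_univ := by rw [Q.proj_univ, map_one]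
  proj_inter S T hS hT := by rw [Q.proj_inter S T hS hT, map_mul]
  hasSum_proj S hS hd f := by
    simp only [conjOp_apply]
    exact (Q.hasSum_proj S hS hd (J.symm f)).map J J.continuous

lemma ProjMeasure.Represents.map (hAB : ∀ f g, (J f, J g) ∈ B.graph ↔ (f, g) ∈ A.graph)
    {Q : ProjMeasure 𝓗} (hQ : Q.Represents A) : (Q.map J).Represents B := by
  intro f
  obtain ⟨f, rfl⟩ := J.surjective f
  obtain ⟨μ, hμ, hdom, hint⟩ := hQ f
  refine ⟨μ, fun S hS => ?_, ?_, fun g hg => ?_⟩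
  · rw [hμ S hS, ProjMeasure.map, conjOp_apply, J.norm_map, J.symm_apply_apply]
  · rw [← hdom, LinearPMap.mem_domain_iff, LinearPMap.mem_domain_iff, J.surjective.exists]
    simp only [hAB]
  · obtain ⟨g, rfl⟩ := J.surjective g
    rw [inner_map_map_of_antilinear, ← inner_conj_symm, hint g ((hAB f g).mp hg),
      Complex.conj_ofReal]

lemma map_starProjection {K : Submodule ℂ 𝓗} {K' : Submodule ℂ 𝓚} [K.HasOrthogonalProjection]
    [K'.HasOrthogonalProjection] (hK : ∀ f, J f ∈ K' ↔ f ∈ K) :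
    K'.starProjection = conjOp J K.starProjection := by
  ext1 f
  obtain ⟨f, rfl⟩ := J.surjective f
  rw [conjOp_apply, J.symm_apply_apply]
  refine Submodule.eq_starProjection_of_mem_of_inner_eq_zero
    ((hK _).mpr (K.starProjection_apply_mem f)) fun w hw => ?_
  obtain ⟨w, rfl⟩ := J.surjective w
  rw [← map_sub, inner_map_map_of_antilinear, ← inner_conj_symm,
    Submodule.starProjection_inner_eq_zero _ _ ((hK w).mp hw), map_zero]

lemma eigenprojection_map (hAB : ∀ f g, (J f, J g) ∈ B.graph ↔ (f, g) ∈ A.graph) (z : ℂ) :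
    eigenprojection B (starRingEnd ℂ z) = conjOp J (eigenprojection A z) := by
  refine map_starProjection J fun f => ?_
  have hpreimage : J ⁻¹' eigenspace B (starRingEnd ℂ z) = eigenspace A z :=
    Set.ext fun f => map_mem_eigenspace_iff J hAB
  have h := J.toHomeomorph.preimage_closure (eigenspace B (starRingEnd ℂ z))
  rw [J.coe_toHomeomorph, hpreimage] at h
  exact Set.ext_iff.mp h f

end Transport

section EigenvectorExpansion

variable {𝕜 𝓗 : Type*} [RCLike 𝕜] [NormedAddCommGroup 𝓗] [InnerProductSpace 𝕜 𝓗]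

lemma inner_eq_zero_of_eigenvalue_ne [CompleteSpace 𝓗] {A : 𝓗 →ₗ.[𝕜] 𝓗} (hA : IsSelfAdjoint A)
    {a b : ℝ} (hab : a ≠ b) {f g : 𝓗} (hf : (f, (a : 𝕜) • f) ∈ A.graph)
    (hg : (g, (b : 𝕜) • g) ∈ A.graph) : inner 𝕜 g f = 0 := by
  have h := inner_comm_of_mem_graph hA hf hg
  rw [inner_smul_left, inner_smul_right, RCLike.conj_ofReal, ← sub_eq_zero, ← sub_mul] at h
  exact (mul_eq_zero.mp h).resolve_left (sub_ne_zero.mpr (RCLike.ofReal_inj.not.mpr hab.symm))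

lemma mem_span_of_forall_inner_eq_zero {ι : Type*} (b : HilbertBasis ι 𝕜 𝓗) (s : Finset ι) {f : 𝓗}
    (hf : ∀ i ∉ s, inner 𝕜 (b i) f = 0) : f ∈ Submodule.span 𝕜 (Set.range fun i : s => b i) := by
  have hsum : ∑ i ∈ s, b.repr f i • b i = f :=
    (hasSum_sum_of_ne_finset_zero (L := .unconditional ι) fun i hi => by
      rw [b.repr_apply_apply, hf i hi, zero_smul]).unique (b.hasSum_repr f)
  rw [← hsum]
  exact Submodule.sum_mem _ fun i hi =>
    Submodule.smul_mem _ _ (Submodule.subset_span ⟨⟨i, hi⟩, rfl⟩)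

end EigenvectorExpansion

section EigenvalueEnumeration

variable {𝓗 : Type} [NormedAddCommGroup 𝓗] [InnerProductSpace ℂ 𝓗] [CompleteSpace 𝓗]
  {e e' : ℕ → ℝ} {A : 𝓗 →ₗ.[ℂ] 𝓗}

/-- If `e m < e' m`, then the first `m + 1` eigenvectors of one basis are orthogonal to all but the
first `m` of the other. -/
lemma IsEigenvalueEnumeration.le (hA : IsSelfAdjoint A) (he : IsEigenvalueEnumeration A e)
    (he' : IsEigenvalueEnumeration A e') (m : ℕ) : e' m ≤ e m := by
  classical
  by_contra! hlt
  obtain ⟨hmono, φ, hφ⟩ := he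
  obtain ⟨hmono', φ', hφ'⟩ := he'
  have hspan (i : Fin (m + 1)) :
      φ i ∈ Submodule.span ℂ (Set.range fun j : Finset.range m => φ' j) :=
    mem_span_of_forall_inner_eq_zero φ' _ fun j hj => by
      have hjm : m ≤ j := not_lt.mp (Finset.mem_range.not.mp hj)
      exact inner_eq_zero_of_eigenvalue_ne hA
        ((hmono i.is_le).trans_lt (hlt.trans_le (hmono' hjm))).ne (hφ i) (hφ' j)
  have hindep : LinearIndependent ℂ fun i : Fin (m + 1) => φ i :=
    φ.orthonormal.linearIndependent.comp _ Fin.val_injective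
  have hcard := (linearIndependent_le_span_aux' _ hindep _ (Set.range_subset_iff.mpr hspan)).trans
    (Fintype.card_range_le _)
  rw [Fintype.card_fin, Fintype.card_coe, Finset.card_range] at hcard
  lia

lemma IsEigenvalueEnumeration.unique (hA : IsSelfAdjoint A) (he : IsEigenvalueEnumeration A e)
    (he' : IsEigenvalueEnumeration A e') : e = e' :=
  funext fun m => le_antisymm (he'.le hA he m) (he.le hA he' m)

end EigenvalueEnumeration

section LpStar

variable {α E : Type*} [MeasurableSpace α] {μ : Measure α} {p : ENNReal} [NormedAddCommGroup E]
  [StarAddMonoid E] [NormedStarGroup E]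

instance : StarAddMonoid (Lp E p μ) where
  star_add f g := by
    apply Lp.ext
    filter_upwards [Lp.coeFn_star (f + g), Lp.coeFn_add f g, Lp.coeFn_add (star f) (star g),
      Lp.coeFn_star f, Lp.coeFn_star g] with x hl hadd hr hf hg
    simp only [hl, hr, hadd, hf, hg, Pi.add_apply, Pi.star_apply, star_add]

instance [Fact (1 ≤ p)] : NormedStarGroup (Lp E p μ) where
  norm_star_le f := Lp.norm_le_norm_of_ae_le <| (Lp.coeFn_star f).mono fun x hx => by
    rw [hx, Pi.star_apply, norm_star]

instance {𝕜 : Type*} [NormedRing 𝕜] [StarRing 𝕜] [Module 𝕜 E] [IsBoundedSMul 𝕜 E]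
    [StarModule 𝕜 E] : StarModule 𝕜 (Lp E p μ) where
  star_smul c f := by
    apply Lp.ext
    filter_upwards [Lp.coeFn_star (c • f), Lp.coeFn_smul c f, Lp.coeFn_smul (star c) (star f),
      Lp.coeFn_star f] with x hl hsmul hr hf
    simp only [hl, hr, hsmul, hf, Pi.smul_apply, Pi.star_apply, star_smul]

end LpStar

section Resolvent

variable {𝓗 : Type} [NormedAddCommGroup 𝓗] [InnerProductSpace ℂ 𝓗] {A : 𝓗 →ₗ.[ℂ] 𝓗} {z : ℂ}
  {R : 𝓗 →L[ℂ] 𝓗}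

lemma IsResolvent.mem_graph_iff (hR : IsResolvent A z R) {f g : 𝓗} :
    (f, g) ∈ A.graph ↔ R (g - z • f) = f := by
  refine ⟨hR.2 f g, fun h => ?_⟩
  simpa only [h, sub_add_cancel] using hR.1 (g - z • f)

lemma IsResolvent.star [CompleteSpace 𝓗] (hA : IsSelfAdjoint A) (hR : IsResolvent A z R) :
    IsResolvent A (starRingEnd ℂ z) (star R) := by
  rw [ContinuousLinearMap.star_eq_adjoint]
  refine ⟨fun f => (mem_graph_iff_of_isSelfAdjoint hA).mpr fun x y hxy => ?_,
    fun f g hfg => ext_inner_left ℂ fun u => ?_⟩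
  · have h := ContinuousLinearMap.adjoint_inner_right R (y - z • x) f
    rw [hR.2 x y hxy, inner_sub_left, inner_smul_left] at h
    rw [inner_add_right, inner_smul_right]
    linear_combination h
  · have h := inner_comm_of_mem_graph hA hfg (hR.1 u)
    rw [inner_add_left, inner_smul_left] at h
    rw [ContinuousLinearMap.adjoint_inner_right, inner_sub_right, inner_smul_right]
    linear_combination -h

end Resolvent

section Cell

variable {d : ℕ} (γ : Module.Basis (Fin d) ℝ (Space d))

lemma neg_mem_cell_iff {x : Space d} : -x ∈ cell γ ↔ x ∈ cell γ := by
  refine forall_congr' fun l => ?_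
  rw [map_neg, Finsupp.neg_apply, Set.mem_Icc, Set.mem_Icc, neg_le_neg_iff, neg_le, and_comm]

lemma closure_interior_cell : closure (interior (cell γ)) = cell γ := by
  have h : cell γ = γ.equivFunL.toHomeomorph ⁻¹'
      (Set.univ.pi fun _ => Set.Icc (-(1 / 2) : ℝ) (1 / 2)) := by
    ext x
    simp only [cell, Set.mem_ofPred_eq, Set.mem_preimage, Set.mem_univ_pi]
    rfl
  rw [h, ← Homeomorph.preimage_interior, ← Homeomorph.preimage_closure,
    interior_pi_set Set.finite_univ, closure_pi_set]
  simp only [closure_interior_Icc (show (-(1 / 2) : ℝ) ≠ 1 / 2 by norm_num)]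

lemma exists_sub_mem_cell (x : Space d) : ∃ a ∈ lattice γ, x - a ∈ cell γ := by
  refine ⟨∑ l, round (γ.repr x l) • γ l,
    Submodule.sum_mem _ fun l _ => Submodule.smul_mem _ _ (Submodule.subset_span ⟨l, rfl⟩),
    fun l => ?_⟩
  have h : γ.repr (∑ l, round (γ.repr x l) • γ l) l = round (γ.repr x l) := by
    simp [← Int.cast_smul_eq_zsmul ℝ, Finsupp.single_apply]
  rw [map_sub, Finsupp.sub_apply, h]
  exact abs_le.mp (abs_sub_round (γ.repr x l))

lemma measure_cell_ne_top : volume (cell γ) ≠ ⊤ := by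
  refine ((measure_mono fun x hx => ?_).trans_lt
    (measure_closedBall_lt_top (x := (0 : Space d)) (r := ∑ l, ‖γ l‖))).ne
  exact mem_closedBall_zero_iff.mpr (norm_le_of_mem_cell γ hx)

lemma ae_brillouinMeasure_iff {p : Space d → Prop} :
    (∀ᵐ k ∂(brillouinMeasure γ), p k) ↔ ∀ᵐ k ∂(volume.restrict (cell (dual γ))), p k :=
  Measure.ae_ennreal_smul_measure_iff (ENNReal.inv_ne_zero.mpr (measure_cell_ne_top (dual γ)))

lemma measurePreserving_neg_brillouinMeasure :
    MeasurePreserving (fun k : Space d => -k) (brillouinMeasure γ) (brillouinMeasure γ) := by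
  have hcell : Neg.neg ⁻¹' cell (dual γ) = cell (dual γ) := Set.ext fun _ => neg_mem_cell_iff _
  have h := (Measure.measurePreserving_neg (volume : Measure (Space d))).restrict_preimage
    (measurableSet_cell (dual γ))
  rw [hcell] at h
  exact h.smul_measure _

lemma memLp_brillouinMeasure_of_continuous {E : Type*} [NormedAddCommGroup E]
    {F : Space d → E} (hF : Continuous F) (p : ENNReal) : MemLp F p (brillouinMeasure γ) := by
  obtain ⟨C, hC⟩ := (isCompact_closedBall (0 : Space d)
    (∑ l, ‖dual γ l‖)).exists_bound_of_continuousOn hF.continuousOn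
  refine MemLp.of_bound hF.aestronglyMeasurable C ?_
  rw [ae_brillouinMeasure_iff]
  filter_upwards [ae_restrict_mem (measurableSet_cell (dual γ))] with k hk
  exact hC k (mem_closedBall_zero_iff.mpr (norm_le_of_mem_cell (dual γ) hk))

lemma eqOn_cell_of_ae_eq {E : Type*} [TopologicalSpace E] [T2Space E] {F G : Space d → E}
    (h : F =ᵐ[brillouinMeasure γ] G) (hF : Continuous F) (hG : Continuous G) :
    Set.EqOn F G (cell (dual γ)) :=
  Measure.eqOn_of_ae_eq ((ae_brillouinMeasure_iff γ).mp h) hF.continuousOn hG.continuousOn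
    (closure_interior_cell (dual γ)).ge

end Cell

section Zak

variable {d : ℕ} (γ : Module.Basis (Fin d) ℝ (Space d))

lemma phase_star (k : Space d) (f : FiberSpace γ) :
    phase γ k (star f) = star (phase γ (-k) f) := by
  apply Lp.ext
  filter_upwards [(memLp_phase γ k (star f)).coeFn_toLp, (memLp_phase γ (-k) f).coeFn_toLp,
    Lp.coeFn_star f, Lp.coeFn_star (phase γ (-k) f)] with y hl hneg hf hr
  rw [hr, Pi.star_apply, phase, phase, hl, hneg, hf, Pi.star_apply, star_mul', Complex.star_def,
    ← Complex.exp_conj, map_mul, Complex.conj_I, Complex.conj_ofReal, inner_neg_right,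
    neg_mul_comm, ← Complex.ofReal_neg, neg_neg]

lemma phase_phase (k k' : Space d) (f : FiberSpace γ) :
    phase γ k (phase γ k' f) = phase γ (k + k') f := by
  apply Lp.ext
  filter_upwards [(memLp_phase γ k (phase γ k' f)).coeFn_toLp,
    (memLp_phase γ k' f).coeFn_toLp, (memLp_phase γ (k + k') f).coeFn_toLp] with y hl hk' hr
  rw [phase, hl, phase, hk', phase, hr, ← mul_assoc, ← Complex.exp_add, inner_add_right, neg_add,
    Complex.ofReal_add, mul_add]

lemma phase_zero (f : FiberSpace γ) : phase γ 0 f = f := by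
  apply Lp.ext
  filter_upwards [(memLp_phase γ 0 f).coeFn_toLp] with y hy
  rw [phase, hy, inner_zero_right, neg_zero, Complex.ofReal_zero, mul_zero, Complex.exp_zero,
    one_mul]

lemma shiftRestrict_star (a : Space d) (ψ : L2 d) :
    shiftRestrict γ a (star ψ) = star (shiftRestrict γ a ψ) := by
  have mp := measurePreserving_add_right (volume : Measure (Space d)) a
  have hcoe (χ : L2 d) :
      shiftRestrict γ a χ =ᵐ[volume.restrict (cell γ)] fun y => χ (y + a) :=
    (LpToLpRestrictCLM_coeFn ℂ (cell γ) _).trans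
      (ae_restrict_of_ae (Lp.coeFn_compMeasurePreserving χ mp))
  apply Lp.ext
  filter_upwards [hcoe (star ψ), hcoe ψ, Lp.coeFn_star (shiftRestrict γ a ψ),
    ae_restrict_of_ae (mp.quasiMeasurePreserving.ae (Lp.coeFn_star ψ))] with y hl hψ hr hstar
  rw [hl, hr, Pi.star_apply, hψ, hstar, Pi.star_apply]

lemma zakSection_star (a : Space d) (ψ : L2 d) (k : Space d) :
    zakSection γ a (star ψ) k = star (zakSection γ a ψ (-k)) := by
  rw [zakSection, zakSection, shiftRestrict_star, phase_star, star_smul, Complex.star_def,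
    ← Complex.exp_conj, map_mul, Complex.conj_I, Complex.conj_ofReal, inner_neg_right,
    neg_mul_comm, ← Complex.ofReal_neg, neg_neg]

/-- The image `Φ ↦ (k ↦ conj Φ(-k))` of complex conjugation under the Bloch-Floquet-Zak
transform. -/
def zakReflect : ZakSpace γ →ₗᵢ⋆[ℂ] ZakSpace γ :=
  (starₗᵢ ℂ : ZakSpace γ ≃ₗᵢ⋆[ℂ] ZakSpace γ).toLinearIsometry.comp
    (Lp.compMeasurePreservingₗᵢ ℂ (fun k : Space d => -k)
      (measurePreserving_neg_brillouinMeasure γ))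

lemma coeFn_zakReflect (Φ : ZakSpace γ) :
    zakReflect γ Φ =ᵐ[brillouinMeasure γ] fun k => star (Φ (-k)) := by
  have mp := measurePreserving_neg_brillouinMeasure γ
  filter_upwards [Lp.coeFn_star (Lp.compMeasurePreserving _ mp Φ),
    Lp.coeFn_compMeasurePreserving Φ mp] with k hstar hneg
  exact hstar.trans (congrArg star hneg)

lemma zakReflect_zakReflect (Φ : ZakSpace γ) : zakReflect γ (zakReflect γ Φ) = Φ := by
  apply Lp.ext
  filter_upwards [coeFn_zakReflect γ (zakReflect γ Φ),
    (measurePreserving_neg_brillouinMeasure γ).quasiMeasurePreserving.ae (coeFn_zakReflect γ Φ)]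
    with k hk hneg
  rw [hk, hneg, star_star, neg_neg]

lemma zak_star (ψ : L2 d) : zak γ (star ψ) = zakReflect γ (zak γ ψ) := by
  rw [zak, zak, Function.LeftInverse.map_tsum _ (zakReflect γ).continuous (zakReflect γ).continuous
    (zakReflect_zakReflect γ)]
  refine tsum_congr fun a => Lp.ext ?_
  filter_upwards [(memLp_zakSection γ (a : Space d) (star ψ)).coeFn_toLp,
    coeFn_zakReflect γ ((memLp_zakSection γ (a : Space d) ψ).toLp _),
    (measurePreserving_neg_brillouinMeasure γ).quasiMeasurePreserving.ae
      (memLp_zakSection γ (a : Space d) ψ).coeFn_toLp] with k hl hr hneg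
  rw [hl, hr, hneg, zakSection_star]

end Zak

section TimeReversal

variable {d : ℕ} {γ : Module.Basis (Fin d) ℝ (Space d)} {A : L2 d →ₗ.[ℂ] L2 d}
  {h : Space d → FiberSpace γ →ₗ.[ℂ] FiberSpace γ}

lemma IsFiberDecomposition.reflect (hd : IsFiberDecomposition γ A h) (hC : CommutesWithConj A)
    {Φ Ξ : ZakSpace γ} (hΦ : ∀ᵐ k ∂(brillouinMeasure γ), (Φ k, Ξ k) ∈ (h k).graph) :
    ∀ᵐ k ∂(brillouinMeasure γ), (star (Φ (-k)), star (Ξ (-k))) ∈ (h k).graph := by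
  obtain ⟨⟨ψ, χ⟩, hψχ, hzak⟩ := (Set.ext_iff.mp hd (Φ, Ξ)).mpr hΦ
  obtain ⟨rfl, rfl⟩ := Prod.mk.inj hzak
  have hstar : ∀ᵐ k ∂(brillouinMeasure γ), (zak γ (star ψ) k, zak γ (star χ) k) ∈ (h k).graph :=
    (Set.ext_iff.mp hd _).mp ⟨(star ψ, star χ), hC ψ χ hψχ, rfl⟩
  rw [zak_star, zak_star] at hstar
  filter_upwards [hstar, coeFn_zakReflect γ (zak γ ψ), coeFn_zakReflect γ (zak γ χ)]
    with k hk hΦk hΞk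
  rwa [hΦk, hΞk] at hk

lemma IsFiberDecomposition.ae_star_resolvent_star (hd : IsFiberDecomposition γ A h)
    (hA : ∀ k, IsSelfAdjoint (h k)) (hC : CommutesWithConj A)
    {R : Space d → FiberSpace γ →L[ℂ] FiberSpace γ}
    (hR : ∀ k, IsResolvent (h k) Complex.I (R k)) (hRc : ∀ f, Continuous fun k => R k f)
    (f : FiberSpace γ) :
    ∀ᵐ k ∂(brillouinMeasure γ), star (R k) (star f) = star (R (-k) f) := by
  have hΦ := memLp_brillouinMeasure_of_continuous γ (hRc f) 2
  have hΞ := memLp_brillouinMeasure_of_continuous γ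
    (F := fun k => f + Complex.I • R k f) (by have := hRc f; fun_prop) 2
  have hreflect := hd.reflect hC (Φ := hΦ.toLp _) (Ξ := hΞ.toLp _) (by
    filter_upwards [hΦ.coeFn_toLp, hΞ.coeFn_toLp] with k hΦk hΞk
    rw [hΦk, hΞk]
    exact (hR k).1 f)
  have qmp := (measurePreserving_neg_brillouinMeasure γ).quasiMeasurePreserving
  filter_upwards [hreflect, qmp.ae hΦ.coeFn_toLp, qmp.ae hΞ.coeFn_toLp] with k hk hΦk hΞk
  rw [hΦk, hΞk, ((hR k).star (hA k)).mem_graph_iff, star_add, star_smul, Complex.star_def,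
    add_sub_cancel_right] at hk
  exact hk

namespace IsContinuouslyFibered

lemma phase_mem_graph_iff (hh : IsContinuouslyFibered γ A h) {k κ : Space d}
    (hκ : κ ∈ lattice (dual γ)) {f g : FiberSpace γ} :
    (phase γ κ f, phase γ κ g) ∈ (h (k + κ)).graph ↔ (f, g) ∈ (h k).graph := by
  refine ⟨fun hfg => ?_, hh.equivariant k κ hκ f g⟩
  simpa only [phase_phase, neg_add_cancel, phase_zero, add_neg_cancel_right]
    using hh.equivariant _ _ (neg_mem hκ) _ _ hfg

lemma star_resolvent_star (hh : IsContinuouslyFibered γ A h) (hC : CommutesWithConj A)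
    {R : Space d → FiberSpace γ →L[ℂ] FiberSpace γ}
    (hR : ∀ k, IsResolvent (h k) Complex.I (R k)) (hRc : ∀ f, Continuous fun k => R k f)
    {k : Space d} (hk : k ∈ cell (dual γ)) (f : FiberSpace γ) :
    star (R k) (star f) = star (R (-k) f) := by
  refine ext_inner_left ℂ fun u => ?_
  have hae : (fun k => inner ℂ (R k u) (star f)) =ᵐ[brillouinMeasure γ]
      fun k => inner ℂ u (star (R (-k) f)) := by
    filter_upwards [hh.decomposition.ae_star_resolvent_star hh.selfAdjoint hC hR hRc f] with k hk
    rw [← hk, ContinuousLinearMap.star_eq_adjoint, ContinuousLinearMap.adjoint_inner_right]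
  rw [ContinuousLinearMap.star_eq_adjoint, ContinuousLinearMap.adjoint_inner_right]
  exact eqOn_cell_of_ae_eq γ hae ((hRc u).inner continuous_const)
    (continuous_const.inner (continuous_star.comp ((hRc f).comp continuous_neg))) hk

lemma star_mem_graph_neg_iff_of_mem_cell (hh : IsContinuouslyFibered γ A h)
    (hC : CommutesWithConj A) {k : Space d} (hk : k ∈ cell (dual γ)) {f g : FiberSpace γ} :
    (star f, star g) ∈ (h (-k)).graph ↔ (f, g) ∈ (h k).graph := by
  obtain ⟨R, hR, hRc⟩ := hh.continuous
  rw [((hR (-k)).star (hh.selfAdjoint (-k))).mem_graph_iff, (hR k).mem_graph_iff,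
    ← Complex.star_def, ← star_smul, ← star_sub,
    hh.star_resolvent_star hC hR hRc ((neg_mem_cell_iff _).mpr hk), neg_neg, star_inj]

theorem star_mem_graph_neg_iff (hh : IsContinuouslyFibered γ A h) (hC : CommutesWithConj A)
    (k : Space d) (f g : FiberSpace γ) :
    (star f, star g) ∈ (h (-k)).graph ↔ (f, g) ∈ (h k).graph := by
  obtain ⟨κ, hκ, hcell⟩ := exists_sub_mem_cell (dual γ) k
  rw [← hh.phase_mem_graph_iff hκ, phase_star, phase_star, neg_add_eq_sub, ← neg_sub,
    hh.star_mem_graph_neg_iff_of_mem_cell hC hcell, sub_eq_add_neg,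
    hh.phase_mem_graph_iff (neg_mem hκ)]

end IsContinuouslyFibered

end TimeReversal

section Projectors

variable {𝓗 : Type} [NormedAddCommGroup 𝓗] [InnerProductSpace ℂ 𝓗] [CompleteSpace 𝓗]
  {𝓚 : Type} [NormedAddCommGroup 𝓚] [InnerProductSpace ℂ 𝓚] [CompleteSpace 𝓚]
  {A : 𝓗 →ₗ.[ℂ] 𝓗} {B : 𝓚 →ₗ.[ℂ] 𝓚} {S : Set ℝ} {T T' : 𝓗 →L[ℂ] 𝓗}

lemma IsSpectralProjection.isStarProjection (hS : MeasurableSet S)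
    (hT : IsSpectralProjection A S T) : IsStarProjection T := by
  obtain ⟨Q, -, rfl⟩ := hT
  exact Q.isStarProjection S hS

lemma IsSpectralProjection.unique (hA : IsSelfAdjoint A) (hS : MeasurableSet S)
    (hT : IsSpectralProjection A S T) (hT' : IsSpectralProjection A S T') : T = T' := by
  obtain ⟨Q, hQ, rfl⟩ := hT
  obtain ⟨Q', hQ', rfl⟩ := hT'
  exact hQ.proj_eq hQ' hA hS

lemma IsSpectralProjection.map (J : 𝓗 ≃ₗᵢ⋆[ℂ] 𝓚)
    (hAB : ∀ f g, (J f, J g) ∈ B.graph ↔ (f, g) ∈ A.graph) (hT : IsSpectralProjection A S T) :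
    IsSpectralProjection B S (conjOp J T) := by
  obtain ⟨Q, hQ, rfl⟩ := hT
  exact ⟨Q.map J, hQ.map J hAB, rfl⟩

end Projectors

section ProjectorSymmetry

variable {d : ℕ} {γ : Module.Basis (Fin d) ℝ (Space d)} {A : L2 d →ₗ.[ℂ] L2 d}
  {h : Space d → FiberSpace γ →ₗ.[ℂ] FiberSpace γ}

theorem IsContinuouslyFibered.spectralProjection_neg (hh : IsContinuouslyFibered γ A h)
    (hC : CommutesWithConj A) {S : Set ℝ} (hS : MeasurableSet S)
    {P : Space d → FiberSpace γ →L[ℂ] FiberSpace γ}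
    (hP : ∀ k, IsSpectralProjection (h k) S (P k)) (k : Space d) :
    P (-k) = conjOp (starₗᵢ ℂ) (P k) :=
  (hP (-k)).unique (hh.selfAdjoint (-k)) hS
    ((hP k).map (starₗᵢ ℂ) (hh.star_mem_graph_neg_iff hC k))

theorem IsContinuouslyFibered.eigenprojection_neg (hh : IsContinuouslyFibered γ A h)
    (hC : CommutesWithConj A) {e : Space d → ℕ → ℝ}
    (he : ∀ k, IsEigenvalueEnumeration (h k) (e k)) (m : ℕ) (k : Space d) :
    eigenprojection (h (-k)) (e (-k) m : ℂ) =
      conjOp (starₗᵢ ℂ) (eigenprojection (h k) (e k m : ℂ)) := by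
  have hgraph := hh.star_mem_graph_neg_iff hC k
  have heven : e (-k) = e k :=
    (he (-k)).unique (hh.selfAdjoint (-k)) ((he k).map (starₗᵢ ℂ) hgraph)
  rw [heven, ← eigenprojection_map (starₗᵢ ℂ) hgraph, Complex.conj_ofReal]

variable {I : Set ℝ} {h : Space d → ℝ → FiberSpace γ →ₗ.[ℂ] FiberSpace γ}
  {P : Space d → ℝ → FiberSpace γ →L[ℂ] FiberSpace γ} {t : ℝ}

lemma IsFermiProjector.exists_isSpectralProjection {H : ℝ → L2 d →ₗ.[ℂ] L2 d}
    (hP : IsFermiProjector γ I H h P) (ht : t ∈ I) :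
    ∃ S, MeasurableSet S ∧ ∀ k, IsSpectralProjection (h k t) S (P k t) := by
  obtain ⟨E, hE⟩ := hP
  exact ⟨Set.Iio (E t), measurableSet_Iio, (hE t ht).2⟩

lemma IsBlochProjector.exists_isEigenvalueEnumeration (hP : IsBlochProjector γ I h P)
    (ht : t ∈ I) :
    ∃ (e : Space d → ℕ → ℝ) (m : ℕ), ∀ k,
      IsEigenvalueEnumeration (h k t) (e k) ∧ P k t = eigenprojection (h k t) (e k m : ℂ) := by
  obtain ⟨e, m, hE⟩ := hP
  exact ⟨fun k => e k t, m, fun k => ⟨(hE t ht).1 k, (hE t ht).2.2 k⟩⟩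

end ProjectorSymmetry

section Calculus

variable {𝕜 E F R : Type*} [NontriviallyNormedField 𝕜] [NormedAddCommGroup E] [NormedSpace 𝕜 E]
  [NormedAddCommGroup F] [NormedSpace 𝕜 F] [NormedRing R] [NormedAlgebra 𝕜 R]

lemma fderivWithin_eq_mul_add_mul {p : E → R} {s : Set E} {x : E}
    (hp : ∀ q ∈ s, IsIdempotentElem (p q)) (hs : UniqueDiffWithinAt 𝕜 s x) (hx : x ∈ s) (v : E) :
    fderivWithin 𝕜 p s x v = p x * fderivWithin 𝕜 p s x v + fderivWithin 𝕜 p s x v * p x := by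
  by_cases hd : DifferentiableWithinAt 𝕜 p s x
  · have hpp : Set.EqOn p (fun q => p q * p q) s := fun q hq => (hp q hq).eq.symm
    have hmul := (hd.hasFDerivWithinAt.mul' hd.hasFDerivWithinAt).fderivWithin hs
    exact DFunLike.congr_fun ((fderivWithin_congr hpp (hpp hx)).trans hmul) v
  · simp only [fderivWithin_zero_of_not_differentiableWithinAt hd, zero_apply, mul_zero, zero_mul,
      add_zero]

lemma isSelfAdjoint_fderivWithin [StarRing 𝕜] [TrivialStar 𝕜] [StarAddMonoid F] [StarModule 𝕜 F]
    [ContinuousStar F] {f : E → F} {s : Set E} {x : E} (hf : ∀ q ∈ s, IsSelfAdjoint (f q))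
    (hs : UniqueDiffWithinAt 𝕜 s x) (hx : x ∈ s) (v : E) :
    IsSelfAdjoint (fderivWithin 𝕜 f s x v) := by
  have hstar : Set.EqOn f (fun q => star (f q)) s := fun q hq => (hf q hq).star_eq.symm
  exact (DFunLike.congr_fun
    ((fderivWithin_congr hstar (hstar hx)).trans (fderivWithin_star hs)) v).symm

variable {f : E → F} (L : F ≃L[𝕜] F) (hL : ∀ q, f (-q) = L (f q))
include hL

lemma differentiableAt_neg_iff_of_map_neg {x : E} :
    DifferentiableAt 𝕜 f (-x) ↔ DifferentiableAt 𝕜 f x := by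
  have hcomp : f ∘ ContinuousLinearEquiv.neg 𝕜 = L ∘ f := funext hL
  rw [← L.comp_differentiableAt_iff (f := f) (x := x), ← hcomp,
    ContinuousLinearEquiv.comp_right_differentiableAt_iff, ContinuousLinearEquiv.neg_apply]

lemma fderiv_neg_of_map_neg (x v : E) : fderiv 𝕜 f (-x) v = -L (fderiv 𝕜 f x v) := by
  have hcomp : f ∘ ContinuousLinearEquiv.neg 𝕜 = L ∘ f := funext hL
  have h := congrArg (fun g => fderiv 𝕜 g x v) hcomp
  simp only [ContinuousLinearEquiv.comp_right_fderiv, ContinuousLinearEquiv.comp_fderiv] at h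
  change fderiv 𝕜 f (-x) (-v) = L (fderiv 𝕜 f x v) at h
  rw [← h, map_neg, neg_neg]

end Calculus

section OffDiagonal

variable {R : Type*} [Ring R] {p a b : R}

lemma mul_mul_comm_of_offDiagonal (ha : a = p * a + a * p) (hb : b = p * b + b * p) :
    p * (a * b) = a * b * p := by
  have hpa : p * a = a - a * p := eq_sub_of_add_eq ha.symm
  have hpb : p * b = b - b * p := eq_sub_of_add_eq hb.symm
  rw [← mul_assoc, hpa, sub_mul, mul_assoc a p b, hpb]
  noncomm_ring

lemma star_mul_commutator_of_offDiagonal [StarRing R] (hp : IsSelfAdjoint p)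
    (ha : IsSelfAdjoint a) (hb : IsSelfAdjoint b) (hpa : a = p * a + a * p)
    (hpb : b = p * b + b * p) : star (p * (a * b - b * a)) = -(p * (a * b - b * a)) := by
  rw [star_mul, star_sub, star_mul, star_mul, hp.star_eq, ha.star_eq, hb.star_eq, sub_mul,
    ← mul_mul_comm_of_offDiagonal hpb hpa, ← mul_mul_comm_of_offDiagonal hpa hpb, mul_sub, neg_sub]

end OffDiagonal

/-- The real scalar action on `Lp` is not the restriction of the complex one by definition, so the
general instance `StarModule ℝ` for complex star modules does not apply to operators on `Lp`. -/
instance instStarModuleReal {𝓗 : Type*} [NormedAddCommGroup 𝓗] [InnerProductSpace ℂ 𝓗]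
    [CompleteSpace 𝓗] [NormedSpace ℝ 𝓗] [IsScalarTower ℝ ℂ 𝓗] : StarModule ℝ (𝓗 →L[ℂ] 𝓗) where
  star_smul c T := by
    rw [star_trivial c, ← algebraMap_smul ℂ c T, ← algebraMap_smul ℂ c (star T), star_smul,
      Complex.coe_algebraMap, Complex.star_def, Complex.conj_ofReal]

section Curvature

variable {d : ℕ} {γ : Module.Basis (Fin d) ℝ (Space d)} {I : Set ℝ}
  {P : Space d → ℝ → FiberSpace γ →L[ℂ] FiberSpace γ} {t : ℝ}

lemma star_curvatureOp (hI : UniqueDiffOn ℝ I) (hP : ∀ k, ∀ t ∈ I, IsStarProjection (P k t))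
    (ht : t ∈ I) (j : Fin d) (k : Space d) :
    star (curvatureOp I P j k t) = -curvatureOp I P j k t := by
  have hsa : ∀ q ∈ Set.univ, IsSelfAdjoint (P q t) := fun q _ => (hP q t ht).isSelfAdjoint
  have hid : ∀ q ∈ Set.univ, IsIdempotentElem (P q t) := fun q _ => (hP q t ht).isIdempotentElem
  rw [curvatureOp, dt, dk, ← fderivWithin_derivWithin, ← fderivWithin_univ]
  exact star_mul_commutator_of_offDiagonal (hP k t ht).isSelfAdjoint
    (isSelfAdjoint_fderivWithin (fun s hs => (hP k s hs).isSelfAdjoint) (hI t ht) ht 1)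
    (isSelfAdjoint_fderivWithin hsa uniqueDiffWithinAt_univ (Set.mem_univ k) _)
    (fderivWithin_eq_mul_add_mul (fun s hs => (hP k s hs).isIdempotentElem) (hI t ht) ht 1)
    (fderivWithin_eq_mul_add_mul hid uniqueDiffWithinAt_univ (Set.mem_univ k) _)

variable {J : FiberSpace γ ≃ₗᵢ⋆[ℂ] FiberSpace γ}

lemma dk_neg (hJ : ∀ k, P (-k) t = conjOp J (P k t)) (j : Fin d) (k : Space d) :
    dk P j (-k) t = -conjOp J (dk P j k t) :=
  fderiv_neg_of_map_neg (conjOpₗᵢ J).toContinuousLinearEquiv hJ k _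

lemma dt_neg {k : Space d} (hJ : ∀ t ∈ I, P (-k) t = conjOp J (P k t)) (hI : UniqueDiffOn ℝ I)
    (ht : t ∈ I) : dt I P (-k) t = conjOp J (dt I P k t) := by
  rw [dt, derivWithin_congr hJ (hJ t ht), dt, ← fderivWithin_derivWithin,
    ← fderivWithin_derivWithin]
  exact DFunLike.congr_fun
    ((conjOpₗᵢ J).toContinuousLinearEquiv.comp_fderivWithin (f := P k) (hI t ht)) 1

lemma differentiableWithinAt_neg_iff {k : Space d} (hJ : ∀ t ∈ I, P (-k) t = conjOp J (P k t))
    (ht : t ∈ I) :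
    DifferentiableWithinAt ℝ (P (-k)) I t ↔ DifferentiableWithinAt ℝ (P k) I t := by
  rw [← (conjOpₗᵢ J).toContinuousLinearEquiv.comp_differentiableWithinAt_iff (f := P k)]
  exact ⟨fun h => h.congr (fun s hs => (hJ s hs).symm) (hJ t ht).symm,
    fun h => h.congr hJ (hJ t ht)⟩

lemma curvatureOp_neg (hI : UniqueDiffOn ℝ I) (hJ : ∀ k, ∀ t ∈ I, P (-k) t = conjOp J (P k t))
    (ht : t ∈ I) (j : Fin d) (k : Space d) :
    curvatureOp I P j (-k) t = conjOp J (-curvatureOp I P j k t) := by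
  rw [curvatureOp, curvatureOp, hJ k t ht, dt_neg (hJ k) hI ht, dk_neg (fun k => hJ k t ht)]
  rw [conjOp_neg, map_mul (conjOp J), conjOp_sub, map_mul (conjOp J), map_mul (conjOp J)]
  noncomm_ring

section

variable (hI : UniqueDiffOn ℝ I) (hP : ∀ k, ∀ t ∈ I, IsStarProjection (P k t))
  (hJ : ∀ k, ∀ t ∈ I, P (-k) t = conjOp J (P k t)) (ht : t ∈ I)
include hI hP hJ ht

lemma hasTrace_curvatureOp_neg_iff (j : Fin d) (k : Space d) (z : ℂ) :
    HasTrace (curvatureOp I P j (-k) t) z ↔ HasTrace (curvatureOp I P j k t) z := by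
  have hneg (k : Space d) (h : HasTrace (curvatureOp I P j k t) z) :
      HasTrace (curvatureOp I P j (-k) t) z := by
    rw [curvatureOp_neg hI hJ ht, ← star_curvatureOp hI hP ht]
    simpa only [Complex.conj_conj] using h.star.conjOp J
  exact ⟨fun h => by simpa only [neg_neg] using hneg (-k) h, hneg k⟩

theorem piezocurvatureExists_neg_iff (k : Space d) :
    PiezocurvatureExists I P (-k) t ↔ PiezocurvatureExists I P k t := by
  have hk := differentiableAt_neg_iff_of_map_neg (x := k) (f := fun q => P q t)
    (conjOpₗᵢ J).toContinuousLinearEquiv fun k => hJ k t ht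
  have htrace (j : Fin d) := exists_congr (hasTrace_curvatureOp_neg_iff hI hP hJ ht j k)
  have htime := differentiableWithinAt_neg_iff (hJ k) ht
  exact ⟨fun h => ⟨hk.mp h.1, htime.mp h.2, fun j => (htrace j).mp (h.3 j)⟩,
    fun h => ⟨hk.mpr h.1, htime.mpr h.2, fun j => (htrace j).mpr (h.3 j)⟩⟩

theorem piezocurvature_neg (k : Space d) : piezocurvature I P (-k) t = piezocurvature I P k t :=
  funext fun j => congrArg (-Complex.I * ·) <|
    trace_congr (hasTrace_curvatureOp_neg_iff hI hP hJ ht j k)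

end

end Curvature

end Piezo

end

theorem mainTheorem5_general {d : ℕ} (γ : Module.Basis (Fin d) ℝ (Piezo.Space d))
    (I : Set ℝ) (hI : UniqueDiffOn ℝ I)
    (H : ℝ → Piezo.L2 d →ₗ.[ℂ] Piezo.L2 d)
    (hC : ∀ t ∈ I, Piezo.CommutesWithConj (H t))
    (h : Piezo.Space d → ℝ → Piezo.FiberSpace γ →ₗ.[ℂ] Piezo.FiberSpace γ)
    (hh : ∀ t ∈ I, Piezo.IsContinuouslyFibered γ (H t) (fun k => h k t))
    (P : Piezo.Space d → ℝ → Piezo.FiberSpace γ →L[ℂ] Piezo.FiberSpace γ)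
    (hP : ∀ t ∈ I,
      (∃ S, MeasurableSet S ∧ ∀ k, Piezo.IsSpectralProjection (h k t) S (P k t)) ∨
      ∃ (e : Piezo.Space d → ℕ → ℝ) (m : ℕ), ∀ k, Piezo.IsEigenvalueEnumeration (h k t) (e k) ∧
        P k t = Piezo.eigenprojection (h k t) (e k m : ℂ)) :
    (∀ k, ∀ t ∈ I, ∀ φ, P k t φ = star (P (-k) t (star φ))) ∧
    (∀ k, ∀ t ∈ I,
      (Piezo.PiezocurvatureExists I P (-k) t ↔ Piezo.PiezocurvatureExists I P k t) ∧
      Piezo.piezocurvature I P (-k) t = Piezo.piezocurvature I P k t) := by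
  have hproj (k : Piezo.Space d) (t : ℝ) (ht : t ∈ I) : IsStarProjection (P k t) := by
    obtain ⟨S, hS, hP⟩ | ⟨e, m, hP⟩ := hP t ht
    · exact (hP k).isStarProjection hS
    · exact (hP k).2 ▸ isStarProjection_starProjection
  have hsymm (k : Piezo.Space d) (t : ℝ) (ht : t ∈ I) :
      P (-k) t = Piezo.conjOp (starₗᵢ ℂ) (P k t) := by
    obtain ⟨S, hS, hP⟩ | ⟨e, m, hP⟩ := hP t ht
    · exact (hh t ht).spectralProjection_neg (hC t ht) hS hP k
    · rw [(hP (-k)).2, (hP k).2]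
      exact (hh t ht).eigenprojection_neg (hC t ht) (fun k => (hP k).1) m k
  refine ⟨fun k t ht φ => ?_, fun k t ht => ⟨Piezo.piezocurvatureExists_neg_iff hI hproj hsymm ht k,
    Piezo.piezocurvature_neg hI hproj hsymm ht k⟩⟩
  have hsymm_neg := DFunLike.congr_fun (hsymm (-k) t ht) φ
  rwa [neg_neg] at hsymm_neg

theorem mainTheorem5 {d : ℕ} (γ : Module.Basis (Fin d) ℝ (Piezo.Space d))
    (I : Set ℝ) (hI : I.OrdConnected) (hI' : I.Nontrivial)
    (H : ℝ → Piezo.L2 d →ₗ.[ℂ] Piezo.L2 d)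
    (hH : ∀ t ∈ I, IsSelfAdjoint (H t))
    (hC : ∀ t ∈ I, Piezo.CommutesWithConj (H t))
    (h : Piezo.Space d → ℝ → Piezo.FiberSpace γ →ₗ.[ℂ] Piezo.FiberSpace γ)
    (hh : ∀ t ∈ I, Piezo.IsContinuouslyFibered γ (H t) (fun k => h k t))
    (P : Piezo.Space d → ℝ → Piezo.FiberSpace γ →L[ℂ] Piezo.FiberSpace γ)
    (hP : Piezo.IsFermiProjector γ I H h P ∨ Piezo.IsBlochProjector γ I h P) :
    (∀ k, ∀ t ∈ I, ∀ φ, P k t φ = star (P (-k) t (star φ))) ∧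
    (∀ k, ∀ t ∈ I,
      (Piezo.PiezocurvatureExists I P (-k) t ↔ Piezo.PiezocurvatureExists I P k t) ∧
      Piezo.piezocurvature I P (-k) t = Piezo.piezocurvature I P k t) :=
  mainTheorem5_general γ I
    (uniqueDiffOn_convex hI.convex (hI.convex.nontrivial_iff_nonempty_interior.mp hI')) H hC h hh P
    fun _ ht => hP.imp (·.exists_isSpectralProjection ht) (·.exists_isEigenvalueEnumeration ht)
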